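/- Work with linear functionals on the $*$-algebra $\mathbb{C}[x]$ ($x^*=x$); a state (distribution) is a unital, $*$-compatible, positive definite functional. For a unital functional $\phi$ let $M^\phi(z)=\sum_{n\ge1}\phi[x^n]z^n$, let $\eta^\phi=1-(1+M^\phi)^{-1}$ be its Boolean cumulant series, and let $R^\phi$ be its free cumulant series, defined by $M^\phi(w)=R^\phi\bigl((1+M^\phi(w))w\bigr)$. Unital functionals are determined by $R$, and also by $\eta$; $\boxplus$ and $\uplus$ denote the operations which add $R$, respectively $\eta$, and $\phi^{\boxplus t}$, $\phi^{\uplus t}$ are given by $tR^\phi$, $t\eta^\phi$. A state $\rho$ is freely infinitely divisible if $\rho^{\boxplus t}$ is a state for every $t\ge0$. The functional $\Phi[\rho,\psi]$ is defined by $\eta^{\Phi[\rho,\psi]}(w)=(1+M^\psi(w))^{-1}R^\rho\bigl((1+M^\psi(w))w\bigr)$. For $b\in\mathbb{R}$ and $1+c\ge0$, the normalized free Meixner distribution $\mu_{b,c}$ is the state with Jacobi parameters $(0,b,b,\dots)$, $(1,1+c,1+c,\dots)$; the un-normalized free Meixner distributions, of mean $a\in\mathbb{R}$ and variance $v>0$,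 are $\mu_{b,c}^{\uplus v}\uplus\delta_a$. **Proposition.** Let $\rho,\psi$ be freely infinitely divisible states on $\mathbb{C}[x]$, and suppose that $\phi=\Phi[\rho,\psi]$ is an un-normalized free Meixner distribution. Then all the functionals $\phi(t)=\Phi[\rho^{\boxplus t},\psi^{\boxplus t}]$, $t>0$, are un-normalized free Meixner distributions if and only if $\rho$ is an un-normalized free Meixner distribution and $\psi=\rho^{\boxplus(1+s)}\boxplus\delta_\alpha$ for some real $s\ge-1$ and $\alpha\in\mathbb{R}$. If moreover $\phi$ is a normalized free Meixner distribution, the same equivalence holds with "$\rho$ is a normalized free Meixner distribution" on the right-hand side. The Boolean evolution ($\psi=\delta_0$) and the free evolution ($\psi=\rho$) preserve the free Meixner class: if $\rho$ is freely infinitely divisible, $\psi$ is one of these two, and $\Phi[\rho,\psi]$ is un-normalized free Meixner, then so is $\Phi[\rho^{\boxplus t},\psi^{\boxplus t}]$ for every $t>0$. The general c-free evolution does not: there are freely infinitely divisible $\rho,\psi$ such that $\Phi[\rho,\psi]$ is a normalized free Meixner distribution, while $\Phi[\rho^{\boxplus t},\psi^{\boxplus t}]$ is not un-normalized free Meixner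 for some $t>0$. -/

import Mathlib

namespace CFree

open PowerSeries

noncomputable section

/-- Linear functionals on `ℂ[x]`. -/
abbrev Functional := Polynomial ℂ →ₗ[ℂ] ℂ

/-- A state on the `*`-algebra `ℂ[x]` (with `x` self-adjoint, so that `p* = p.map conj`): a unital,
`*`-compatible, positive definite functional.  By `*`-compatibility `φ (p* p)` is real. -/
structure IsState (φ : Functional) : Prop where
  map_one : φ 1 = 1
  map_star : ∀ p : Polynomial ℂ, φ (p.map (starRingEnd ℂ)) = starRingEnd ℂ (φ p)
  nonneg : ∀ p : Polynomial ℂ, 0 ≤ (φ (p.map (starRingEnd ℂ) * p)).re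

/-- The point mass `δ_a[p] = p(a)`. -/
def dirac (a : ℝ) : Functional := Polynomial.leval (a : ℂ)

/-! ### Moments -/

/-- The moment generating function `M^φ(z) = ∑_{n ≥ 1} φ[xⁿ] zⁿ`. -/
def momentSeries (φ : Functional) : ℂ⟦X⟧ :=
  PowerSeries.mk fun n => if n = 0 then 0 else φ (Polynomial.X ^ n)

/-- The unital functional whose `n`-th moment, `n ≥ 1`, is the `n`-th coefficient of `M`. -/
def ofMomentSeries (M : ℂ⟦X⟧) : Functional :=
  (Polynomial.basisMonomials ℂ).constr ℂ fun n => if n = 0 then 1 else coeff n M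

theorem constantCoeff_momentSeries (φ : Functional) : constantCoeff (momentSeries φ) = 0 := by
  simp [momentSeries, ← coeff_zero_eq_constantCoeff_apply]

theorem ofMomentSeries_X_pow (M : ℂ⟦X⟧) (n : ℕ) :
    ofMomentSeries M (Polynomial.X ^ n) = if n = 0 then 1 else coeff n M := by
  have h := (Polynomial.basisMonomials ℂ).constr_basis ℂ
    (fun n => if n = 0 then (1 : ℂ) else coeff n M) n
  simp only [Polynomial.coe_basisMonomials, Polynomial.monomial_one_right_eq_X_pow] at h
  exact h

theorem ofMomentSeries_one (M : ℂ⟦X⟧) : ofMomentSeries M 1 = 1 := by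
  simpa using ofMomentSeries_X_pow M 0

theorem momentSeries_ofMomentSeries {M : ℂ⟦X⟧} (hM : constantCoeff M = 0) :
    momentSeries (ofMomentSeries M) = M := by
  ext n
  rcases Nat.eq_zero_or_pos n with rfl | hn
  · simp [momentSeries, hM]
  · simp [momentSeries, ofMomentSeries_X_pow, hn.ne']

theorem ofMomentSeries_momentSeries {φ : Functional} (hφ : φ 1 = 1) :
    ofMomentSeries (momentSeries φ) = φ := by
  refine (Polynomial.basisMonomials ℂ).ext fun n => ?_
  simp only [Polynomial.coe_basisMonomials, Polynomial.monomial_one_right_eq_X_pow,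
    ofMomentSeries_X_pow]
  rcases Nat.eq_zero_or_pos n with rfl | hn
  · simp [hφ]
  · simp [momentSeries, hn.ne']

/-! ### Boolean cumulants -/

/-- The Boolean cumulant generating function `η^φ = 1 - (1 + M^φ)⁻¹`. -/
def booleanCumulantSeries (φ : Functional) : ℂ⟦X⟧ := 1 - (1 + momentSeries φ)⁻¹

/-- The unital functional with Boolean cumulant generating function `H` (where `H(0) = 0`). -/
def ofBooleanCumulantSeries (H : ℂ⟦X⟧) : Functional := ofMomentSeries ((1 - H)⁻¹ - 1)

theorem booleanCumulantSeries_ofBooleanCumulantSeries {H : ℂ⟦X⟧} (hH : constantCoeff H = 0) :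
    booleanCumulantSeries (ofBooleanCumulantSeries H) = H := by
  have h0 : constantCoeff (1 - H) ≠ 0 := by simp [hH]
  have h1 : constantCoeff ((1 - H)⁻¹) ≠ 0 := by simp [hH]
  have h2 : constantCoeff ((1 - H)⁻¹ - 1) = 0 := by simp [hH]
  rw [booleanCumulantSeries, ofBooleanCumulantSeries, momentSeries_ofMomentSeries h2,
    add_sub_cancel, (PowerSeries.inv_eq_iff_mul_eq_one h1).2 (PowerSeries.mul_inv_cancel _ h0)]
  ring

theorem ofBooleanCumulantSeries_booleanCumulantSeries {φ : Functional} (hφ : φ 1 = 1) :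
    ofBooleanCumulantSeries (booleanCumulantSeries φ) = φ := by
  have h0 : constantCoeff (1 + momentSeries φ) ≠ 0 := by simp [constantCoeff_momentSeries]
  have h1 : constantCoeff ((1 + momentSeries φ)⁻¹) ≠ 0 := by simp [constantCoeff_momentSeries]
  rw [ofBooleanCumulantSeries, booleanCumulantSeries, sub_sub_cancel,
    (PowerSeries.inv_eq_iff_mul_eq_one h1).2 (PowerSeries.mul_inv_cancel _ h0),
    add_sub_cancel_left, ofMomentSeries_momentSeries hφ]

/-! ### Free cumulants -/

open Classical in
/-- The inverse under composition of a series `u X + O(X²)`, `u ≠ 0` (and `0` otherwise). -/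
def compInv (P : ℂ⟦X⟧) : ℂ⟦X⟧ :=
  if h : IsUnit (coeff 1 P) then P.substInvOfIsUnit h else 0

/-- The free cumulant generating function `R^φ`: the solution of `M^φ(w) = R^φ((1 + M^φ(w)) w)`. -/
def freeCumulantSeries (φ : Functional) : ℂ⟦X⟧ :=
  (momentSeries φ).subst (compInv (X * (1 + momentSeries φ)))

/-- The unital functional with free cumulant generating function `R` (where `R(0) = 0`): its moment
generating function is `R(z(w))`, where `z(w)` is the inverse of `w = z / (1 + R(z))`. -/
def ofFreeCumulantSeries (R : ℂ⟦X⟧) : Functional :=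
  ofMomentSeries (R.subst (compInv (X * (1 + R)⁻¹)))

theorem hasSubst_compInv (P : ℂ⟦X⟧) : HasSubst (compInv P) := by
  unfold compInv
  split_ifs with h
  · exact HasSubst.substInvOfIsUnit P h
  · exact HasSubst.zero'

theorem constantCoeff_compInv (P : ℂ⟦X⟧) : constantCoeff (compInv P) = 0 := by
  unfold compInv
  split_ifs with h <;> simp

theorem subst_compInv {Q : ℂ⟦X⟧} (hQ : constantCoeff Q ≠ 0) :
    (X * Q).subst (compInv (X * Q)) = X := by
  have h : IsUnit (coeff 1 (X * Q)) := by
    rw [show (1 : ℕ) = 0 + 1 from rfl, coeff_succ_X_mul]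
    simpa using hQ
  rw [compInv, dif_pos h]
  exact subst_substInvOfIsUnit_right _ (by simp) h

theorem compInv_subst {Q : ℂ⟦X⟧} (hQ : constantCoeff Q ≠ 0) :
    (compInv (X * Q)).subst (X * Q) = X := by
  have h : IsUnit (coeff 1 (X * Q)) := by
    rw [show (1 : ℕ) = 0 + 1 from rfl, coeff_succ_X_mul]
    simpa using hQ
  rw [compInv, dif_pos h]
  exact subst_substInvOfIsUnit_left _ (by simp) h

theorem freeCumulantSeries_spec (φ : Functional) :
    (freeCumulantSeries φ).subst (X * (1 + momentSeries φ)) = momentSeries φ := by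
  have h0 : constantCoeff (1 + momentSeries φ) ≠ 0 := by simp [constantCoeff_momentSeries]
  rw [freeCumulantSeries, subst_comp_subst_apply (hasSubst_compInv _)
    (HasSubst.of_constantCoeff_zero' (by simp)), compInv_subst h0, X_subst]

theorem constantCoeff_freeCumulantSeries (φ : Functional) :
    constantCoeff (freeCumulantSeries φ) = 0 :=
  constantCoeff_subst_eq_zero (constantCoeff_compInv _) _ (constantCoeff_momentSeries φ)

/-- The free cumulant generating function is the only solution of its implicit equation. -/
theorem freeCumulantSeries_unique {φ : Functional} {R : ℂ⟦X⟧}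
    (h : R.subst (X * (1 + momentSeries φ)) = momentSeries φ) : R = freeCumulantSeries φ := by
  have h0 : constantCoeff (1 + momentSeries φ) ≠ 0 := by simp [constantCoeff_momentSeries]
  have e : PowerSeries.subst (compInv (X * (1 + momentSeries φ)))
      (PowerSeries.subst (X * (1 + momentSeries φ)) R : ℂ⟦X⟧) = R := by
    rw [subst_comp_subst_apply (HasSubst.of_constantCoeff_zero' (by simp)) (hasSubst_compInv _),
      subst_compInv h0, X_subst]
  rw [h] at e
  exact e.symm

theorem ofFreeCumulantSeries_equation {R : ℂ⟦X⟧} (hR : constantCoeff R = 0) :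
    momentSeries (ofFreeCumulantSeries R) =
      R.subst (X * (1 + momentSeries (ofFreeCumulantSeries R))) := by
  have hR0 : constantCoeff (1 + R) ≠ 0 := by simp [hR]
  have hR1 : constantCoeff ((1 + R)⁻¹) ≠ 0 := by simp [hR]
  have hz : HasSubst (compInv (X * (1 + R)⁻¹)) := hasSubst_compInv _
  have hM : constantCoeff (R.subst (compInv (X * (1 + R)⁻¹)) : ℂ⟦X⟧) = 0 :=
    constantCoeff_subst_eq_zero (constantCoeff_compInv _) _ hR
  have e1 := subst_compInv hR1
  have e2 : (1 + R).subst (compInv (X * (1 + R)⁻¹)) *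
      ((1 + R)⁻¹).subst (compInv (X * (1 + R)⁻¹)) = (1 : ℂ⟦X⟧) := by
    rw [← subst_mul hz, PowerSeries.mul_inv_cancel _ hR0, ← coe_substAlgHom hz, map_one]
  have e3 : (1 + R).subst (compInv (X * (1 + R)⁻¹)) =
      1 + (R.subst (compInv (X * (1 + R)⁻¹)) : ℂ⟦X⟧) := by
    rw [← coe_substAlgHom hz, map_add, map_one]
  rw [subst_mul hz, subst_X hz] at e1
  rw [e3] at e2
  have e4 : X * (1 + (R.subst (compInv (X * (1 + R)⁻¹)) : ℂ⟦X⟧)) = compInv (X * (1 + R)⁻¹) := by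
    calc _ = compInv (X * (1 + R)⁻¹) * (((1 + R)⁻¹).subst (compInv (X * (1 + R)⁻¹))) *
          (1 + (R.subst (compInv (X * (1 + R)⁻¹)) : ℂ⟦X⟧)) := by rw [e1]
      _ = compInv (X * (1 + R)⁻¹) * ((1 + (R.subst (compInv (X * (1 + R)⁻¹)) : ℂ⟦X⟧)) *
          (((1 + R)⁻¹).subst (compInv (X * (1 + R)⁻¹)))) := by ring
      _ = _ := by rw [e2, mul_one]
  rw [ofFreeCumulantSeries, momentSeries_ofMomentSeries hM, e4]

theorem freeCumulantSeries_ofFreeCumulantSeries {R : ℂ⟦X⟧} (hR : constantCoeff R = 0) :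
    freeCumulantSeries (ofFreeCumulantSeries R) = R :=
  (freeCumulantSeries_unique (ofFreeCumulantSeries_equation hR).symm).symm

/-! ### Convolutions -/

/-- The free convolution `φ ⊞ ψ`: `R^{φ ⊞ ψ} = R^φ + R^ψ`. -/
def freeConv (φ ψ : Functional) : Functional :=
  ofFreeCumulantSeries (freeCumulantSeries φ + freeCumulantSeries ψ)

/-- The free convolution power `φ^{⊞ t}`: its free cumulant generating function is `t R^φ`. -/
def freePow (φ : Functional) (t : ℝ) : Functional :=
  ofFreeCumulantSeries ((t : ℂ) • freeCumulantSeries φ)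

/-- The Boolean convolution `φ ⊎ ψ`: `η^{φ ⊎ ψ} = η^φ + η^ψ`. -/
def booleanConv (φ ψ : Functional) : Functional :=
  ofBooleanCumulantSeries (booleanCumulantSeries φ + booleanCumulantSeries ψ)

/-- The Boolean convolution power `φ^{⊎ t}`: its Boolean cumulant generating function is `t η^φ`. -/
def booleanPow (φ : Functional) (t : ℝ) : Functional :=
  ofBooleanCumulantSeries ((t : ℂ) • booleanCumulantSeries φ)

/-- `ρ` is freely infinitely divisible: it is a state and all `ρ^{⊞ t}`, `t ≥ 0`, are states. -/
def IsFreelyInfinitelyDivisible (ρ : Functional) : Prop :=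
  IsState ρ ∧ ∀ t : ℝ, 0 ≤ t → IsState (freePow ρ t)

/-- The map `Φ[ρ, ψ]`: the unital functional `φ` with
`η^φ(w) = (1 + M^ψ(w))⁻¹ R^ρ((1 + M^ψ(w)) w)`. -/
def Phi (ρ ψ : Functional) : Functional :=
  ofBooleanCumulantSeries
    ((1 + momentSeries ψ)⁻¹ * (freeCumulantSeries ρ).subst (X * (1 + momentSeries ψ)))

/-! ### Free Meixner distributions -/

/-- The monic polynomials with Jacobi parameters `(β 0, β 1, …)`, `(γ 1, γ 2, …)`:
`P₀ = 1`, `P₁ = x - β 0`, `x Pₙ = Pₙ₊₁ + β n Pₙ + γ n Pₙ₋₁`. -/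
def jacobiPolynomial (β γ : ℕ → ℝ) : ℕ → Polynomial ℂ
  | 0 => 1
  | 1 => Polynomial.X - Polynomial.C (β 0 : ℂ)
  | n + 2 => (Polynomial.X - Polynomial.C (β (n + 1) : ℂ)) * jacobiPolynomial β γ (n + 1)
      - Polynomial.C (γ (n + 1) : ℂ) * jacobiPolynomial β γ n

/-- `φ` has Jacobi parameters `(β 0, β 1, …)`, `(γ 1, γ 2, …)`: the polynomials defined by the
three-term recursion are orthogonal with respect to `φ`. (For a unital `φ`, the case of `P₀` against
`Pₙ` already determines `φ`.) -/
def HasJacobiParameters (φ : Functional) (β γ : ℕ → ℝ) : Prop :=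
  ∀ m n : ℕ, m ≠ n → φ (jacobiPolynomial β γ m * jacobiPolynomial β γ n) = 0

/-- `φ = μ_{b,c}`: the state with Jacobi parameters `(0, b, b, …)`, `(1, 1 + c, 1 + c, …)`. -/
def IsMeixnerLaw (b c : ℝ) (φ : Functional) : Prop :=
  IsState φ ∧
    HasJacobiParameters φ (fun n => if n = 0 then 0 else b) (fun n => if n = 1 then 1 else 1 + c)

/-- (Normalized) free Meixner distributions: `μ_{b,c}` with `b ∈ ℝ`, `1 + c ≥ 0`. They have mean `0`
and variance `1`. -/
def IsNormalizedFreeMeixner (φ : Functional) : Prop :=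
  ∃ b c : ℝ, 0 ≤ 1 + c ∧ IsMeixnerLaw b c φ

/-- Un-normalized free Meixner distributions, of mean `a` and variance `v > 0`:
`μ_{b,c}^{⊎ v} ⊎ δ_a`. -/
def IsFreeMeixner (φ : Functional) : Prop :=
  ∃ (μ : Functional) (v a : ℝ), IsNormalizedFreeMeixner μ ∧ 0 < v ∧
    φ = booleanConv (booleanPow μ v) (dirac a)

end

end CFree

namespace CFree

open PowerSeries

/-! ### Series and functionals -/

/-! In Boolean cumulants, the free Meixner class is η = w(a + vG) with G = w(1 + bG + dG²), v > 0, d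
= 1 + c ≥ 0 (`isFreeMeixner_iff`). Substituting the inverse of u = w(1 + M^ψ(w)) turns this
condition on Φ[ρ,ψ] into one on R = R^ρ and S = R^ψ (`hasMeixnerCumulants_Phi_iff`): R = z(a + vg)
and (1 + S)g = z(1 + bg + dg²).

The evolution multiplies R and S by t. Since g = z + O(z²), R determines a, v and g, so g is the
same for all t, and the quadratic equation must hold with tS for S. Being affine in t, it splits
into g = z(1 + βg + γg²) and S = z(b − β + (d − γ)g), so S is a linear combination of R and z. At
time t the quadratic coefficient is γ + t(d − γ); its sign gives γ ≥ 0 and s ≥ −1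
(`IsMeixnerPair.of_evolution`). Conversely, such R and S solve the equations at every t, and the
quadratic coefficient is nonnegative because ρ^{⊞r} is a state for small r. For the Boolean
evolution S = 0 and the equation for g does not move; the free one is the case ψ = ρ.

The counterexample takes g = zA, where A = (1 − 4z²)^{-1/2} is the arcsine moment series. Since A² =
1 + 4(zA)², R = z²A and S = A − 1 form a Meixner pair, but S is not a combination of R and z. Free
infinite divisibility comes from the sufficient half of the free Lévy–Khintchine formula, proved
algebraically: the moment series is a limit of iterates built by positivity-preserving operations,
namely Boolean convolution with a point mass, mixing, and adjoining one level of Jacobi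
coefficients. -/

theorem constantCoeff_one_add_momentSeries_ne_zero (φ : Functional) :
    constantCoeff (1 + momentSeries φ) ≠ 0 := by simp [constantCoeff_momentSeries]

theorem one_add_momentSeries_ne_zero (φ : Functional) : 1 + momentSeries φ ≠ 0 := fun h =>
  constantCoeff_one_add_momentSeries_ne_zero φ (by rw [h, map_zero])

theorem hasSubst_X_mul (D : ℂ⟦X⟧) : HasSubst (X * D) :=
  HasSubst.of_constantCoeff_zero' (by simp)

theorem subst_const {a : ℂ⟦X⟧} (z : ℂ) : (C z : ℂ⟦X⟧).subst a = (C z : ℂ⟦X⟧) :=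
  subst_C z

theorem subst_one_series {a : ℂ⟦X⟧} : (1 : ℂ⟦X⟧).subst a = (1 : ℂ⟦X⟧) := by
  rw [← map_one C, subst_const]

theorem eq_of_momentSeries_eq {φ ψ : Functional} (hφ : φ 1 = 1) (hψ : ψ 1 = 1)
    (h : momentSeries φ = momentSeries ψ) : φ = ψ := by
  rw [← ofMomentSeries_momentSeries hφ, h, ofMomentSeries_momentSeries hψ]

theorem eq_of_booleanCumulantSeries_eq {φ ψ : Functional} (hφ : φ 1 = 1) (hψ : ψ 1 = 1)
    (h : booleanCumulantSeries φ = booleanCumulantSeries ψ) : φ = ψ := by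
  rw [← ofBooleanCumulantSeries_booleanCumulantSeries hφ, h,
    ofBooleanCumulantSeries_booleanCumulantSeries hψ]

theorem constantCoeff_booleanCumulantSeries (φ : Functional) :
    constantCoeff (booleanCumulantSeries φ) = 0 := by
  simp [booleanCumulantSeries, constantCoeff_momentSeries]

theorem mul_one_sub_booleanCumulantSeries (φ : Functional) :
    (1 + momentSeries φ) * (1 - booleanCumulantSeries φ) = 1 := by
  rw [booleanCumulantSeries, sub_sub_cancel,
    PowerSeries.mul_inv_cancel _ (constantCoeff_one_add_momentSeries_ne_zero φ)]

theorem booleanCumulantSeries_eq_iff {φ : Functional} {H : ℂ⟦X⟧} :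
    booleanCumulantSeries φ = H ↔ (1 + momentSeries φ) * (1 - H) = 1 := by
  constructor
  · rintro rfl
    exact mul_one_sub_booleanCumulantSeries φ
  · intro h
    have := mul_left_cancel₀ (one_add_momentSeries_ne_zero φ)
      (h.trans (mul_one_sub_booleanCumulantSeries φ).symm)
    linear_combination this

theorem ofBooleanCumulantSeries_one (H : ℂ⟦X⟧) : ofBooleanCumulantSeries H 1 = 1 :=
  ofMomentSeries_one _

theorem ofFreeCumulantSeries_one (R : ℂ⟦X⟧) : ofFreeCumulantSeries R 1 = 1 :=
  ofMomentSeries_one _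

/-- The inverse function `w(u)` of `u(w) = w (1 + M(w))`. -/
noncomputable def momentInv (φ : Functional) : ℂ⟦X⟧ := compInv (X * (1 + momentSeries φ))

theorem hasSubst_momentInv (φ : Functional) : HasSubst (momentInv φ) := hasSubst_compInv _

theorem momentSeries_subst_momentInv (φ : Functional) :
    (momentSeries φ).subst (momentInv φ) = freeCumulantSeries φ := rfl

theorem one_add_momentSeries_subst_momentInv (φ : Functional) :
    (1 + momentSeries φ).subst (momentInv φ) = 1 + freeCumulantSeries φ := by
  rw [subst_add (hasSubst_momentInv φ), subst_one_series, momentSeries_subst_momentInv]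

theorem momentInv_mul (φ : Functional) : momentInv φ * (1 + freeCumulantSeries φ) = X := by
  have h := subst_compInv (constantCoeff_one_add_momentSeries_ne_zero φ)
  change (X * (1 + momentSeries φ)).subst (momentInv φ) = X at h
  rwa [subst_mul (hasSubst_momentInv φ), subst_X (hasSubst_momentInv φ),
    one_add_momentSeries_subst_momentInv] at h

theorem subst_subst_momentInv (φ : Functional) (f : ℂ⟦X⟧) :
    PowerSeries.subst (momentInv φ) (PowerSeries.subst (X * (1 + momentSeries φ)) f : ℂ⟦X⟧)
      = f := by
  rw [subst_comp_subst_apply (hasSubst_X_mul _) (hasSubst_momentInv φ), momentInv,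
    subst_compInv (constantCoeff_one_add_momentSeries_ne_zero φ), X_subst]

theorem subst_momentInv_subst (φ : Functional) (f : ℂ⟦X⟧) :
    PowerSeries.subst (X * (1 + momentSeries φ)) (PowerSeries.subst (momentInv φ) f : ℂ⟦X⟧)
      = f := by
  rw [subst_comp_subst_apply (hasSubst_momentInv φ) (hasSubst_X_mul _), momentInv,
    compInv_subst (constantCoeff_one_add_momentSeries_ne_zero φ), X_subst]

/-- R determines w(u) = u/(1 + R(u)), hence its inverse u(w) = w(1 + M(w)), hence M. -/
theorem ofFreeCumulantSeries_freeCumulantSeries {φ : Functional} (hφ : φ 1 = 1) :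
    ofFreeCumulantSeries (freeCumulantSeries φ) = φ := by
  refine eq_of_momentSeries_eq (ofFreeCumulantSeries_one _) hφ ?_
  set ψ := ofFreeCumulantSeries (freeCumulantSeries φ) with hψ
  have hR : freeCumulantSeries ψ = freeCumulantSeries φ :=
    freeCumulantSeries_ofFreeCumulantSeries (constantCoeff_freeCumulantSeries φ)
  have hne : (1 + freeCumulantSeries φ) ≠ 0 := fun h => by
    have := congrArg constantCoeff h
    simp [constantCoeff_freeCumulantSeries] at this
  have hW : momentInv ψ = momentInv φ := by
    apply mul_right_cancel₀ hne
    rw [momentInv_mul, ← hR, momentInv_mul]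
  have h1 := subst_subst_momentInv ψ X
  have h2 := subst_momentInv_subst φ (X * (1 + momentSeries ψ))
  rw [subst_X (hasSubst_X_mul _)] at h1
  rw [← hW, h1, subst_X (hasSubst_X_mul _)] at h2
  have := mul_left_cancel₀ X_ne_zero h2
  linear_combination -this

theorem eq_of_freeCumulantSeries_eq {φ ψ : Functional} (hφ : φ 1 = 1) (hψ : ψ 1 = 1)
    (h : freeCumulantSeries φ = freeCumulantSeries ψ) : φ = ψ := by
  rw [← ofFreeCumulantSeries_freeCumulantSeries hφ, h, ofFreeCumulantSeries_freeCumulantSeries hψ]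

theorem freeCumulantSeries_freePow (φ : Functional) (t : ℝ) :
    freeCumulantSeries (freePow φ t) = C (t : ℂ) * freeCumulantSeries φ := by
  rw [freePow, smul_eq_C_mul, freeCumulantSeries_ofFreeCumulantSeries]
  simp [constantCoeff_freeCumulantSeries]

theorem freeCumulantSeries_freeConv (φ ψ : Functional) :
    freeCumulantSeries (freeConv φ ψ) = freeCumulantSeries φ + freeCumulantSeries ψ := by
  rw [freeConv, freeCumulantSeries_ofFreeCumulantSeries]
  simp [constantCoeff_freeCumulantSeries]

theorem booleanCumulantSeries_booleanPow (φ : Functional) (t : ℝ) :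
    booleanCumulantSeries (booleanPow φ t) = C (t : ℂ) * booleanCumulantSeries φ := by
  rw [booleanPow, smul_eq_C_mul, booleanCumulantSeries_ofBooleanCumulantSeries]
  simp [constantCoeff_booleanCumulantSeries]

theorem booleanCumulantSeries_booleanConv (φ ψ : Functional) :
    booleanCumulantSeries (booleanConv φ ψ) =
      booleanCumulantSeries φ + booleanCumulantSeries ψ := by
  rw [booleanConv, booleanCumulantSeries_ofBooleanCumulantSeries]
  simp [constantCoeff_booleanCumulantSeries]

theorem booleanCumulantSeries_dirac (a : ℝ) :
    booleanCumulantSeries (dirac a) = C (a : ℂ) * X := by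
  have h : 1 + momentSeries (dirac a) = PowerSeries.mk fun n => (a : ℂ) ^ n := by
    ext n
    rcases n with _ | n
    · simp [constantCoeff_momentSeries]
    · simp [momentSeries, dirac, coeff_one]
  rw [booleanCumulantSeries_eq_iff, h]
  ext n
  rcases n with _ | n
  · simp
  · rw [mul_sub, mul_one, mul_comm (C (a : ℂ)) X, ← mul_assoc, map_sub, coeff_mul_C,
      coeff_succ_mul_X]
    simp [pow_succ, coeff_one]

theorem freeCumulantSeries_dirac (a : ℝ) : freeCumulantSeries (dirac a) = C (a : ℂ) * X := by
  refine (freeCumulantSeries_unique ?_).symm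
  rw [subst_mul (hasSubst_X_mul _), subst_X (hasSubst_X_mul _), subst_const]
  have := mul_one_sub_booleanCumulantSeries (dirac a)
  rw [booleanCumulantSeries_dirac] at this
  linear_combination -this

theorem booleanCumulantSeries_Phi (ρ ψ : Functional) :
    (1 + momentSeries ψ) * booleanCumulantSeries (Phi ρ ψ) =
      (freeCumulantSeries ρ).subst (X * (1 + momentSeries ψ)) := by
  rw [Phi, booleanCumulantSeries_ofBooleanCumulantSeries, ← mul_assoc,
    PowerSeries.mul_inv_cancel _ (constantCoeff_one_add_momentSeries_ne_zero ψ), one_mul]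
  have h : constantCoeff ((freeCumulantSeries ρ).subst (X * (1 + momentSeries ψ)) : ℂ⟦X⟧) = 0 :=
    constantCoeff_subst_eq_zero
      (show constantCoeff (X * (1 + momentSeries ψ)) = 0 by simp) _
      (constantCoeff_freeCumulantSeries ρ)
  rw [map_mul, h, mul_zero]

theorem Phi_one (ρ ψ : Functional) : Phi ρ ψ 1 = 1 := ofBooleanCumulantSeries_one _

theorem Phi_self {ρ : Functional} (hρ : ρ 1 = 1) : Phi ρ ρ = ρ := by
  refine eq_of_booleanCumulantSeries_eq (Phi_one _ _) hρ ?_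
  apply mul_left_cancel₀ (one_add_momentSeries_ne_zero ρ)
  rw [booleanCumulantSeries_Phi, freeCumulantSeries_spec]
  linear_combination mul_one_sub_booleanCumulantSeries ρ

/-! ### Functionals of Meixner type -/

/-- `φ` is unital with Boolean cumulant series `a w + v w G(w)`, `G = w (1 + b G + d G²)`. -/
def HasMeixnerCumulants (a v b d : ℝ) (φ : Functional) : Prop :=
  φ 1 = 1 ∧ ∃ G : ℂ⟦X⟧, booleanCumulantSeries φ = X * (C (a : ℂ) + C (v : ℂ) * G) ∧
    G = X * (1 + C (b : ℂ) * G + C (d : ℂ) * G ^ 2)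

/-- The relation between free cumulant series `R` and `S` which expresses that `Φ` of the
corresponding functionals has Boolean cumulants of Meixner type. -/
def IsMeixnerPair (a v b d : ℝ) (R S : ℂ⟦X⟧) : Prop :=
  ∃ g : ℂ⟦X⟧, R = X * (C (a : ℂ) + C (v : ℂ) * g) ∧
    (1 + S) * g = X * (1 + C (b : ℂ) * g + C (d : ℂ) * g ^ 2)

/-- Change of variable: with u = w(1 + M^ψ(w)) one has w(u)(1 + S(u)) = u, and g is G(w(u)). -/
theorem hasMeixnerCumulants_Phi_iff {a v b d : ℝ} {ρ ψ : Functional} :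
    HasMeixnerCumulants a v b d (Phi ρ ψ) ↔
      IsMeixnerPair a v b d (freeCumulantSeries ρ) (freeCumulantSeries ψ) := by
  have hη := booleanCumulantSeries_Phi ρ ψ
  constructor
  · rintro ⟨-, G, h1, h2⟩
    have hW := hasSubst_momentInv ψ
    have hWS := momentInv_mul ψ
    refine ⟨G.subst (momentInv ψ), ?_, ?_⟩
    · rw [h1] at hη
      have := congrArg (PowerSeries.subst (momentInv ψ)) hη
      rw [subst_subst_momentInv, subst_mul hW, one_add_momentSeries_subst_momentInv] at this
      simp only [subst_mul hW, subst_add hW, subst_X hW, subst_const] at this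
      rw [← this, ← hWS]
      ring
    · have := congrArg (PowerSeries.subst (momentInv ψ)) h2
      rw [subst_mul hW, subst_add hW, subst_add hW, subst_mul hW, subst_mul hW,
        subst_pow hW, subst_X hW, subst_const, subst_const, subst_one_series] at this
      generalize (PowerSeries.subst (momentInv ψ) G : ℂ⟦X⟧) = g at *
      rw [← hWS]
      linear_combination (1 + freeCumulantSeries ψ) * this
  · rintro ⟨g, h1, h2⟩
    have hU := hasSubst_X_mul (1 + momentSeries ψ)
    refine ⟨Phi_one _ _, g.subst (X * (1 + momentSeries ψ)), ?_, ?_⟩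
    · apply mul_left_cancel₀ (one_add_momentSeries_ne_zero ψ)
      rw [hη, h1, subst_mul hU, subst_add hU, subst_mul hU, subst_X hU, subst_const, subst_const]
      ring
    · have := congrArg (PowerSeries.subst (X * (1 + momentSeries ψ))) h2
      simp only [subst_mul hU, subst_add hU, subst_pow hU, subst_X hU, subst_const,
        subst_one_series, freeCumulantSeries_spec] at this
      apply mul_left_cancel₀ (one_add_momentSeries_ne_zero ψ)
      linear_combination this

theorem hasMeixnerCumulants_iff {a v b d : ℝ} {ρ : Functional} (hρ : ρ 1 = 1) :
    HasMeixnerCumulants a v b d ρ ↔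
      IsMeixnerPair a v b d (freeCumulantSeries ρ) (freeCumulantSeries ρ) := by
  rw [← hasMeixnerCumulants_Phi_iff, Phi_self hρ]

/-- This normalization of g makes the decomposition R = z(a + vg) unique when v ≠ 0. -/
theorem coeff_of_one_add_mul_eq {b d : ℂ} {S g : ℂ⟦X⟧} (hS : constantCoeff S = 0)
    (h : (1 + S) * g = X * (1 + C b * g + C d * g ^ 2)) :
    constantCoeff g = 0 ∧ coeff 1 g = 1 := by
  have h0 : constantCoeff g = 0 := by simpa [hS] using congrArg constantCoeff h
  refine ⟨h0, ?_⟩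
  have h1 := congrArg (coeff 1) h
  rw [show (1 : ℕ) = 0 + 1 from rfl, coeff_succ_X_mul, coeff_mul,
    Finset.Nat.antidiagonal_succ] at h1
  simpa [hS, h0] using h1

theorem linear_combination_inj {a v a' v' : ℂ} {g g' : ℂ⟦X⟧} (hg : constantCoeff g = 0)
    (hg' : constantCoeff g' = 0) (hg1 : coeff 1 g = 1) (hg1' : coeff 1 g' = 1)
    (h : C a + C v * g = C a' + C v' * g') : a = a' ∧ v = v' := by
  have h0 := congrArg constantCoeff h
  have h1 := congrArg (coeff 1) h
  simp only [map_add, map_mul, constantCoeff_C, hg, hg', coeff_C_mul, hg1, hg1', coeff_C] at h0 h1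
  constructor
  · simpa using h0
  · simpa using h1

theorem ne_zero_of_coeff_one {g : ℂ⟦X⟧} (hg1 : coeff 1 g = 1) : g ≠ 0 := by
  rintro rfl
  simp at hg1

/-- If `Φ` stays in the Meixner class along the evolution, then `R` is of Meixner type and `S` is an
affine function of it. -/
theorem IsMeixnerPair.of_evolution {a v b d : ℝ} {R S : ℂ⟦X⟧} (hS : constantCoeff S = 0)
    (hv : 0 < v) (h : IsMeixnerPair a v b d R S)
    (ht : ∀ t : ℝ, 0 < t → ∃ a' v' b' d' : ℝ, 0 < v' ∧ 0 ≤ d' ∧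
      IsMeixnerPair a' v' b' d' (C (t : ℂ) * R) (C (t : ℂ) * S)) :
    (∃ b' d' : ℝ, 0 ≤ d' ∧ IsMeixnerPair a v b' d' R R) ∧
      ∃ s α : ℝ, -1 ≤ s ∧ S = C ((1 + s : ℝ) : ℂ) * R + C (α : ℂ) * X := by
  obtain ⟨g, hR, hg⟩ := h
  obtain ⟨hg0, hg1⟩ := coeff_of_one_add_mul_eq hS hg
  have hgne := ne_zero_of_coeff_one hg1
  have hv0 : (v : ℂ) ≠ 0 := by exact_mod_cast hv.ne'
  -- Uniqueness of the decomposition of tR forces the same g at every time.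
  have key : ∀ t : ℝ, 0 < t → ∃ b' d' : ℝ, 0 ≤ d' ∧
      (1 + C (t : ℂ) * S) * g = X * (1 + C (b' : ℂ) * g + C (d' : ℂ) * g ^ 2) := by
    intro t htpos
    obtain ⟨a', v', b', d', hv', hd', g', hR', hg'⟩ := ht t htpos
    obtain ⟨hg0', hg1'⟩ := coeff_of_one_add_mul_eq (by simp [hS]) hg'
    have e : C (t * a : ℂ) + C (t * v : ℂ) * g = C (a' : ℂ) + C (v' : ℂ) * g' := by
      apply mul_left_cancel₀ (X_ne_zero (R := ℂ))
      rw [← hR', hR, map_mul, map_mul]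
      ring
    obtain ⟨e1, e2⟩ := linear_combination_inj hg0 hg0' hg1 hg1' e
    rw [e1, e2] at e
    have hv0' : (C (v' : ℂ) : ℂ⟦X⟧) ≠ 0 := by
      rw [Ne, map_eq_zero_iff _ C_injective]
      exact_mod_cast hv'.ne'
    have : g = g' := mul_left_cancel₀ hv0' (add_left_cancel e)
    subst this
    exact ⟨b', d', hd', hg'⟩
  -- The equation is affine in t: twice the one at t = 1 minus the one at t = 2 is its value at t =
  -- 0.
  obtain ⟨b₂, d₂, -, h₂⟩ := key 2 two_pos
  set β := 2 * b - b₂ with hβ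
  set γ := 2 * d - d₂ with hγ
  have hgq : g = X * (1 + C (β : ℂ) * g + C (γ : ℂ) * g ^ 2) := by
    rw [hβ, hγ]
    push_cast
    push_cast at h₂
    simp only [map_sub, map_mul, map_ofNat] at h₂ ⊢
    linear_combination 2 * hg - h₂
  have hSq : S = X * (C ((b - β : ℝ) : ℂ) + C ((d - γ : ℝ) : ℂ) * g) := by
    apply mul_right_cancel₀ hgne
    push_cast
    simp only [map_sub]
    linear_combination hg - hgq
  have hd : ∀ t : ℝ, 0 < t → 0 ≤ γ + t * (d - γ) := by
    intro t htpos
    obtain ⟨b', d', hd', h'⟩ := key t htpos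
    have e : C (b' : ℂ) + C (d' : ℂ) * g =
        C ((β + t * (b - β) : ℝ) : ℂ) + C ((γ + t * (d - γ) : ℝ) : ℂ) * g := by
      apply mul_left_cancel₀ (mul_ne_zero (X_ne_zero (R := ℂ)) hgne)
      rw [hSq] at h'
      push_cast at h' ⊢
      simp only [map_sub, map_mul, map_add] at h' ⊢
      linear_combination hgq - h'
    have := (linear_combination_inj hg0 hg0 hg1 hg1 e).2
    have h3 : d' = γ + t * (d - γ) := by exact_mod_cast this
    exact h3 ▸ hd'
  -- If γ < 0, a small t violates `hd`: the one chosen gives t(d − γ) ≤ −γ/2.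
  have hγ0 : 0 ≤ γ := by
    by_contra! hneg
    have h1 : 0 < 1 + |d - γ| := by positivity
    have := hd (-γ / (2 * (1 + |d - γ|))) (div_pos (by linarith) (by positivity))
    have h2 : -γ / (2 * (1 + |d - γ|)) * (d - γ) ≤ -γ / 2 := by
      rw [div_mul_eq_mul_div, div_le_div_iff₀ (by positivity) two_pos]
      nlinarith [le_abs_self (d - γ)]
    linarith
  -- If d < γ, a large t violates `hd`: the one chosen gives the value −1.
  have hσ0 : 0 ≤ d - γ := by
    by_contra! hneg
    have := hd ((γ + 1) / (γ - d)) (div_pos (by linarith) (by linarith))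
    have h2 : (γ + 1) / (γ - d) * (d - γ) = -(γ + 1) := by
      rw [div_mul_eq_mul_div, div_eq_iff (by linarith)]
      ring
    linarith
  -- Adding Rg = z(ag + vg²) to the equation for g gives β + a and γ + v; eliminating g between R
  -- and S gives 1 + s = (d − γ)/v and α.
  refine ⟨⟨β + a, γ + v, by positivity, g, hR, ?_⟩, (d - γ) / v - 1, b - β - (d - γ) / v * a, ?_, ?_⟩
  · rw [hR]
    push_cast
    simp only [map_add]
    linear_combination hgq
  · have : 0 ≤ (d - γ) / v := by positivity
    linarith
  · have hx : (C ((d - γ : ℝ) : ℂ) : ℂ⟦X⟧) = C (((d - γ) / v : ℝ) : ℂ) * C (v : ℂ) := by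
      rw [← map_mul]
      congr 1
      push_cast
      rw [div_mul_cancel₀ _ hv0]
    rw [hSq, hR, hx]
    rw [add_sub_cancel]
    push_cast
    simp only [map_sub, map_mul]
    ring

/-- Conversely, if `R` is of Meixner type and `S` is an affine function of it, then all the pairs
along the evolution are of Meixner type. -/
theorem IsMeixnerPair.evolution {a v b d s α : ℝ} {R S : ℂ⟦X⟧} (h : IsMeixnerPair a v b d R R)
    (hS : S = C ((1 + s : ℝ) : ℂ) * R + C (α : ℂ) * X) (t : ℝ) :
    IsMeixnerPair (t * a) (t * v) (b - a + t * (α + (1 + s) * a)) (d - v + t * ((1 + s) * v))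
      (C (t : ℂ) * R) (C (t : ℂ) * S) := by
  obtain ⟨g, hR, hg⟩ := h
  refine ⟨g, ?_, ?_⟩
  · rw [hR]
    push_cast
    simp only [map_mul]
    ring
  · rw [hS]
    -- After this substitution `hg` amounts to g = z(1 + (b − a)g + (d − v)g²); the goal adds tSg to
    -- both sides.
    rw [hR] at hg ⊢
    push_cast
    simp only [map_sub, map_mul, map_add]
    linear_combination hg

/-! ### Positive definite moment series -/

/-- The functional on `ℝ[x]` whose moments are the coefficients of `D`. -/
noncomputable def momentFunctional (D : ℝ⟦X⟧) : Polynomial ℝ →ₗ[ℝ] ℝ :=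
  (Polynomial.basisMonomials ℝ).constr ℝ fun n => coeff n D

theorem momentFunctional_X_pow (D : ℝ⟦X⟧) (n : ℕ) :
    momentFunctional D (Polynomial.X ^ n) = coeff n D := by
  have h := (Polynomial.basisMonomials ℝ).constr_basis ℝ (fun n => coeff n D) n
  simp only [Polynomial.coe_basisMonomials, Polynomial.monomial_one_right_eq_X_pow] at h
  exact h

theorem momentFunctional_C_mul (D : ℝ⟦X⟧) (a : ℝ) (p : Polynomial ℝ) :
    momentFunctional D (Polynomial.C a * p) = a * momentFunctional D p := by
  rw [← Polynomial.smul_eq_C_mul, map_smul, smul_eq_mul]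

theorem momentFunctional_one (D : ℝ⟦X⟧) : momentFunctional D 1 = coeff 0 D := by
  rw [← momentFunctional_X_pow, pow_zero]

theorem momentFunctional_apply (D : ℝ⟦X⟧) (p : Polynomial ℝ) :
    momentFunctional D p = ∑ i ∈ p.support, p.coeff i * coeff i D := by
  conv_lhs => rw [p.as_sum_support_C_mul_X_pow]
  simp [momentFunctional_C_mul, momentFunctional_X_pow]

/-- The coefficients of `D` are the moments of a positive definite functional. -/
def IsPosDef (D : ℝ⟦X⟧) : Prop := ∀ q : Polynomial ℝ, 0 ≤ momentFunctional D (q * q)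

/-- The vector moments of a symmetric operator are positive definite. -/
theorem isPosDef_of_symmetric {V : Type*} [AddCommGroup V] [Module ℝ V]
    (B : V →ₗ[ℝ] V →ₗ[ℝ] ℝ) (T : V →ₗ[ℝ] V) (Ω : V) (hsymm : ∀ v w, B (T v) w = B v (T w))
    (hpos : ∀ v, 0 ≤ B v v) {D : ℝ⟦X⟧} (hD : ∀ n, coeff n D = B Ω ((T ^ n) Ω)) :
    IsPosDef D := by
  have h1 : ∀ p : Polynomial ℝ, momentFunctional D p = B Ω (Polynomial.aeval T p Ω) := by
    intro p
    induction p using Polynomial.induction_on' with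
    | add p q hp hq => simp [hp, hq]
    | monomial n a =>
      rw [← Polynomial.C_mul_X_pow_eq_monomial, momentFunctional_C_mul, momentFunctional_X_pow, hD]
      simp
  have h2 : ∀ n v w, B ((T ^ n) v) w = B v ((T ^ n) w) := by
    intro n
    induction n with
    | zero => simp
    | succ n ih =>
      intro v w
      rw [pow_succ, Module.End.mul_apply, ih, hsymm, ← Module.End.mul_apply, ← pow_succ',
        ← pow_succ]
  have h3 : ∀ (p : Polynomial ℝ) v w,
      B (Polynomial.aeval T p v) w = B v (Polynomial.aeval T p w) := by
    intro p
    induction p using Polynomial.induction_on' with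
    | add p q hp hq => simp [hp, hq]
    | monomial n a => simp [Polynomial.aeval_monomial, h2]
  intro q
  -- L(q²) = B(Ω, q(T)²Ω) = B(q(T)Ω, q(T)Ω).
  rw [h1, map_mul, Module.End.mul_apply, ← h3]
  exact hpos _

/-- The bilinear form `(f, g) ↦ L(f g)`. -/
noncomputable def momentForm (D : ℝ⟦X⟧) : Polynomial ℝ →ₗ[ℝ] Polynomial ℝ →ₗ[ℝ] ℝ :=
  LinearMap.mk₂ ℝ (fun f g => momentFunctional D (f * g))
    (by simp [add_mul]) (by simp) (by simp [mul_add]) (by simp)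

theorem momentForm_apply (D : ℝ⟦X⟧) (f g : Polynomial ℝ) :
    momentForm D f g = momentFunctional D (f * g) := rfl

/-- The Boolean convolution with a point mass preserves positivity. -/
theorem IsPosDef.boolean_shift {D E : ℝ⟦X⟧} (hD : IsPosDef D) (x : ℝ)
    (hE : E = D + C x * (X * (D * E))) : IsPosDef E := by
  -- E = D/(1 − xwD) collects the moments, at the vector 1, of multiplication by the variable plus
  -- the rank-one perturbation f ↦ x L(f) 1, which is symmetric for L(fg).
  let T : Polynomial ℝ →ₗ[ℝ] Polynomial ℝ :=
    LinearMap.mulLeft ℝ Polynomial.X +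
      (x • momentFunctional D).smulRight (1 : Polynomial ℝ)
  have hT : ∀ f, T f = Polynomial.X * f + Polynomial.C (x * momentFunctional D f) := by
    intro f
    simp [T, Polynomial.smul_eq_C_mul]
  have hE' : ∀ n, coeff (n + 1) E = coeff (n + 1) D + x * coeff n (E * D) := by
    intro n
    conv_lhs => rw [hE]
    rw [map_add, coeff_C_mul, coeff_succ_X_mul, mul_comm D E]
  have hpow : ∀ n, (T ^ (n + 1)) 1 = Polynomial.X ^ (n + 1) +
      ∑ i ∈ Finset.HasAntidiagonal.antidiagonal n, Polynomial.C (x * coeff i.1 E) * Polynomial.X ^ i.2 := by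
    have hE0 : coeff 0 E = coeff 0 D := by rw [hE]; simp
    have hL : ∀ n, momentFunctional D (Polynomial.X ^ (n + 1) +
        ∑ i ∈ Finset.HasAntidiagonal.antidiagonal n, Polynomial.C (x * coeff i.1 E) * Polynomial.X ^ i.2) =
          coeff (n + 1) E := by
      intro n
      rw [hE', coeff_mul, Finset.mul_sum]
      simp [momentFunctional_C_mul, momentFunctional_X_pow, mul_assoc]
    intro n
    induction n with
    | zero => simp [hT, momentFunctional_one, hE0]
    | succ n ih =>
      rw [pow_succ', Module.End.mul_apply, ih, hT, hL, Finset.Nat.sum_antidiagonal_succ',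
        mul_add, Finset.mul_sum]
      have : ∀ i ∈ Finset.HasAntidiagonal.antidiagonal n,
          Polynomial.X * (Polynomial.C (x * coeff i.1 E) * Polynomial.X ^ i.2) =
            Polynomial.C (x * coeff i.1 E) * Polynomial.X ^ (i.2 + 1) := by
        intro i _
        ring
      rw [Finset.sum_congr rfl this, pow_zero, mul_one, pow_succ' _ (n + 1)]
      abel
  refine isPosDef_of_symmetric (momentForm D) T 1 ?_ hD ?_
  · intro f g
    rw [momentForm_apply, momentForm_apply, hT, hT]
    simp only [add_mul, mul_add, map_add, momentFunctional_C_mul,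
      mul_comm f (Polynomial.C _)]
    rw [mul_assoc Polynomial.X, mul_left_comm f]
    ring
  · intro n
    rw [momentForm_apply, one_mul]
    rcases n with _ | n
    · rw [hE]
      simp [momentFunctional_one]
    · rw [hpow, hE', coeff_mul, Finset.mul_sum]
      simp [momentFunctional_C_mul, momentFunctional_X_pow, mul_assoc]

/-- If `Θ` is positive definite, so is `(1 - α w - w² Θ(w))⁻¹`. -/
theorem IsPosDef.coefficient_extension {Θ D : ℝ⟦X⟧} (hΘ : IsPosDef Θ) (α : ℝ)
    (hD : D = 1 + (C α * X + X ^ 2 * Θ) * D) : IsPosDef D := by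
  -- A block Jacobi operator: a new vacuum vector (1, 0) with diagonal entry α is coupled to the
  -- constant polynomial 1 in the space carrying Θ.
  let T : (ℝ × Polynomial ℝ) →ₗ[ℝ] (ℝ × Polynomial ℝ) :=
    LinearMap.prod
      (α • LinearMap.fst ℝ ℝ _ + momentFunctional Θ ∘ₗ LinearMap.snd ℝ ℝ _)
      (Polynomial.CAlgHom.toLinearMap ∘ₗ LinearMap.fst ℝ ℝ _ +
        LinearMap.mulLeft ℝ Polynomial.X ∘ₗ LinearMap.snd ℝ ℝ _)
  let B : (ℝ × Polynomial ℝ) →ₗ[ℝ] (ℝ × Polynomial ℝ) →ₗ[ℝ] ℝ :=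
    LinearMap.mk₂ ℝ (fun v w => v.1 * w.1 + momentFunctional Θ (v.2 * w.2))
      (by intros; simp only [Prod.fst_add, Prod.snd_add, add_mul, map_add]; ring)
      (by intros; simp only [Prod.smul_fst, Prod.smul_snd, smul_mul_assoc, map_smul, smul_add])
      (by intros; simp only [Prod.fst_add, Prod.snd_add, mul_add, map_add]; ring)
      (by intros; simp only [Prod.smul_fst, Prod.smul_snd, mul_smul_comm, map_smul, smul_add])
  have hT : ∀ a f, T (a, f) =
      (α * a + momentFunctional Θ f, Polynomial.C a + Polynomial.X * f) := fun a f => rfl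
  have hB : ∀ a f a' f', B (a, f) (a', f') = a * a' + momentFunctional Θ (f * f') :=
    fun a f a' f' => rfl
  have h0 : coeff 0 D = 1 := by rw [hD]; simp
  have hD' : ∀ n, coeff (n + 2) D = α * coeff (n + 1) D + coeff n (D * Θ) := by
    intro n
    have e : D = 1 + X * (C α * D) + X * (X * (D * Θ)) := by
      conv_lhs => rw [hD]
      ring
    conv_lhs => rw [e]
    rw [map_add, map_add, coeff_succ_X_mul, coeff_succ_X_mul, coeff_succ_X_mul, coeff_C_mul]
    simp [coeff_one]
  have h1 : coeff 1 D = α := by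
    have e : D = 1 + X * (C α * D + X * (D * Θ)) := by
      conv_lhs => rw [hD]
      ring
    rw [e, map_add, show (1 : ℕ) = 0 + 1 from rfl, coeff_succ_X_mul, map_add, coeff_C_mul, h0]
    simp [coeff_one]
  have hpow : ∀ n, (T ^ (n + 1)) (1, 0) = (coeff (n + 1) D,
      ∑ i ∈ Finset.HasAntidiagonal.antidiagonal n, Polynomial.C (coeff i.1 D) * Polynomial.X ^ i.2) := by
    intro n
    induction n with
    | zero => simp only [zero_add, pow_one, hT, h1]; simp [h0]
    | succ n ih =>
      rw [pow_succ', Module.End.mul_apply, ih, hT, hD', Finset.Nat.sum_antidiagonal_succ',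
        Finset.mul_sum, coeff_mul]
      have : ∀ i ∈ Finset.HasAntidiagonal.antidiagonal n,
          Polynomial.X * (Polynomial.C (coeff i.1 D) * Polynomial.X ^ i.2) =
            Polynomial.C (coeff i.1 D) * Polynomial.X ^ (i.2 + 1) := by
        intro i _
        ring
      rw [Finset.sum_congr rfl this]
      simp [momentFunctional_C_mul, momentFunctional_X_pow]
  refine isPosDef_of_symmetric B T (1, 0) ?_ ?_ ?_
  · rintro ⟨a, f⟩ ⟨a', f'⟩
    simp only [hT, hB, add_mul, mul_add, map_add, momentFunctional_C_mul,
      mul_comm f (Polynomial.C _)]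
    rw [mul_assoc Polynomial.X, mul_left_comm f]
    ring
  · rintro ⟨a, f⟩
    rw [hB]
    exact add_nonneg (mul_self_nonneg a) (hΘ f)
  · intro n
    rcases n with _ | n
    · simp [hB, h0]
    · rw [hpow, hB]
      simp

theorem isPosDef_one : IsPosDef 1 := by
  intro q
  have : momentFunctional 1 (q * q) = q.coeff 0 * q.coeff 0 := by
    rw [momentFunctional_apply, ← Polynomial.mul_coeff_zero]
    simp only [coeff_one, mul_ite, mul_one, mul_zero, Finset.sum_ite_eq']
    simp
  rw [this]
  exact mul_self_nonneg _

/-- Positivity at q involves finitely many coefficients, so it passes to coefficientwise limits. -/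
theorem IsPosDef.congr {D E : ℝ⟦X⟧} {q : Polynomial ℝ} (hE : IsPosDef E)
    (h : ∀ n ≤ (q * q).natDegree, coeff n D = coeff n E) : 0 ≤ momentFunctional D (q * q) := by
  have : momentFunctional D (q * q) = momentFunctional E (q * q) := by
    rw [momentFunctional_apply, momentFunctional_apply]
    refine Finset.sum_congr rfl fun i hi => ?_
    rw [h i (Polynomial.le_natDegree_of_mem_supp i hi)]
  rw [this]
  exact hE q

/-- In the geometric series (XD)^k has order at least k. The coefficient is thus a polynomial in x,
to which a functional can be applied. -/
theorem coeff_mul_inv_one_sub (D : ℝ⟦X⟧) (x : ℝ) (n : ℕ) :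
    coeff n (D * (1 - C x * (X * D))⁻¹) =
      ∑ k ∈ Finset.range (n + 1), x ^ k * coeff n (D * (X * D) ^ k) := by
  set y := C x * (X * D) with hy
  have h0 : constantCoeff (1 - y) ≠ 0 := by simp [hy]
  have hinv := PowerSeries.mul_inv_cancel _ h0
  have hgeom := mul_neg_geom_sum y (n + 1)
  have e : D * (1 - y)⁻¹ =
      D * ∑ k ∈ Finset.range (n + 1), y ^ k + X ^ (n + 1) * (C x ^ (n + 1) * D ^ (n + 2) * (1 - y)⁻¹) := by
    have : y ^ (n + 1) = X ^ (n + 1) * (C x ^ (n + 1) * D ^ (n + 1)) := by rw [hy]; ring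
    linear_combination (-D * (1 - y)⁻¹) * hgeom + (D * ∑ k ∈ Finset.range (n + 1), y ^ k) * hinv
      + D * (1 - y)⁻¹ * this
  rw [e, map_add, coeff_X_pow_mul', if_neg (by omega), add_zero, Finset.mul_sum, map_sum]
  refine Finset.sum_congr rfl fun k _ => ?_
  rw [hy, mul_pow, ← map_pow, mul_left_comm, coeff_C_mul]

/-- The moment series of the mixture of the functionals with moment series `D / (1 - x w D)`, with
respect to a functional `κ` in `x`. -/
noncomputable def mixture (κ : Polynomial ℝ →ₗ[ℝ] ℝ) (D : ℝ⟦X⟧) : ℝ⟦X⟧ :=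
  PowerSeries.mk fun n =>
    ∑ k ∈ Finset.range (n + 1), κ (Polynomial.X ^ k) * coeff n (D * (X * D) ^ k)

/-- For fixed q the value at q² of the shifted functional is a polynomial in x, nonnegative for
every x by `IsPosDef.boolean_shift`; the mixture is κ of that polynomial. -/
theorem IsPosDef.mixture {κ : Polynomial ℝ →ₗ[ℝ] ℝ}
    (hκ : ∀ p : Polynomial ℝ, (∀ x, 0 ≤ p.eval x) → 0 ≤ κ p) {D : ℝ⟦X⟧} (hD : IsPosDef D) :
    IsPosDef (mixture κ D) := by
  intro q
  let P : Polynomial ℝ := ∑ i ∈ (q * q).support, Polynomial.C ((q * q).coeff i) *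
    ∑ k ∈ Finset.range (i + 1), Polynomial.C (coeff i (D * (X * D) ^ k)) * Polynomial.X ^ k
  have hP : momentFunctional (CFree.mixture κ D) (q * q) = κ P := by
    rw [momentFunctional_apply, map_sum]
    refine Finset.sum_congr rfl fun i _ => ?_
    rw [← Polynomial.smul_eq_C_mul, map_smul, smul_eq_mul, map_sum, CFree.mixture, coeff_mk]
    congr 1
    refine Finset.sum_congr rfl fun k _ => ?_
    rw [← Polynomial.smul_eq_C_mul, map_smul, smul_eq_mul, mul_comm]
  rw [hP]
  refine hκ P fun x => ?_
  have hx : P.eval x = momentFunctional (D * (1 - C x * (X * D))⁻¹) (q * q) := by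
    rw [momentFunctional_apply, Polynomial.eval_finsetSum]
    refine Finset.sum_congr rfl fun i _ => ?_
    rw [coeff_mul_inv_one_sub, Polynomial.eval_mul, Polynomial.eval_C, Polynomial.eval_finsetSum]
    congr 1
    refine Finset.sum_congr rfl fun k _ => ?_
    rw [Polynomial.eval_mul, Polynomial.eval_C, Polynomial.eval_pow, Polynomial.eval_X, mul_comm]
  rw [hx]
  have hinv := PowerSeries.mul_inv_cancel (1 - C x * (X * D)) (by simp)
  refine hD.boolean_shift x ?_ q
  linear_combination D * hinv

/-- A unital functional whose moment series is real and positive definite is a state. -/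
theorem isState_of_isPosDef {φ : Functional} (hφ : φ 1 = 1) {D : ℝ⟦X⟧} (hD : IsPosDef D)
    (h : 1 + momentSeries φ = D.map Complex.ofRealHom) : IsState φ := by
  have hX : ∀ n, φ (Polynomial.X ^ n) = ((coeff n D : ℝ) : ℂ) := by
    intro n
    have := congrArg (coeff n) h
    rcases n with _ | n
    · simpa [hφ, constantCoeff_momentSeries] using this
    · simpa [momentSeries, coeff_one] using this
  have hm : ∀ n (z : ℂ), φ (Polynomial.monomial n z) = z * ((coeff n D : ℝ) : ℂ) := by
    intro n z
    rw [← Polynomial.C_mul_X_pow_eq_monomial, ← Polynomial.smul_eq_C_mul, map_smul, hX, smul_eq_mul]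
  have hreal : ∀ q : Polynomial ℝ, φ (q.map Complex.ofRealHom) = (momentFunctional D q : ℂ) := by
    intro q
    induction q using Polynomial.induction_on' with
    | add p q hp hq => simp [hp, hq]
    | monomial n a =>
      rw [Polynomial.map_monomial, hm, ← Polynomial.C_mul_X_pow_eq_monomial,
        momentFunctional_C_mul, momentFunctional_X_pow]
      simp
  have hdec : ∀ p : Polynomial ℂ, ∃ q r : Polynomial ℝ,
      p = q.map Complex.ofRealHom + Polynomial.C Complex.I * r.map Complex.ofRealHom := by
    intro p
    induction p using Polynomial.induction_on' with
    | add p p' hp hp' =>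
      obtain ⟨q, r, hq⟩ := hp
      obtain ⟨q', r', hq'⟩ := hp'
      refine ⟨q + q', r + r', ?_⟩
      rw [hq, hq', Polynomial.map_add, Polynomial.map_add]
      ring
    | monomial n z =>
      refine ⟨Polynomial.monomial n z.re, Polynomial.monomial n z.im, ?_⟩
      rw [Polynomial.map_monomial, Polynomial.map_monomial, Polynomial.C_mul_monomial,
        ← map_add]
      congr 1
      simp [mul_comm Complex.I]
  have hconj : ∀ q : Polynomial ℝ, (q.map Complex.ofRealHom).map (starRingEnd ℂ) =
      q.map Complex.ofRealHom := by
    intro q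
    ext n
    simp
  refine ⟨hφ, ?_, ?_⟩
  · intro p
    induction p using Polynomial.induction_on' with
    | add p q hp hq => simp [hp, hq]
    | monomial n z => simp [hm]
  · intro p
    obtain ⟨q, r, rfl⟩ := hdec p
    have hI : (Polynomial.C Complex.I : Polynomial ℂ) ^ 2 = -1 := by
      rw [← map_pow, Complex.I_sq, map_neg, map_one]
    -- For p = q + ir with q, r real, p*p = (q − ir)(q + ir) = q² + r².
    have e : (q.map Complex.ofRealHom + Polynomial.C Complex.I * r.map Complex.ofRealHom).map
          (starRingEnd ℂ) *
        (q.map Complex.ofRealHom + Polynomial.C Complex.I * r.map Complex.ofRealHom) =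
          (q * q + r * r).map Complex.ofRealHom := by
      rw [Polynomial.map_add, Polynomial.map_mul, hconj, hconj, Polynomial.map_C, Complex.conj_I,
        Polynomial.map_add, Polynomial.map_mul, Polynomial.map_mul, map_neg]
      linear_combination (-(r.map Complex.ofRealHom) ^ 2) * hI
    rw [e, hreal, Complex.ofReal_re, map_add]
    exact add_nonneg (hD q) (hD r)

/-! ### The fixed-point equation for the moment series -/

/-- The sum matches the definition of `mixture`: when the coefficients of K are the moments of κ,
the mixture of S is S K(wS). -/
theorem coeff_mul_subst_X_mul (K S : ℂ⟦X⟧) (n : ℕ) :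
    coeff n (S * K.subst (X * S)) =
      ∑ k ∈ Finset.range (n + 1), coeff k K * coeff n (S * (X * S) ^ k) := by
  have hS := hasSubst_X_mul S
  obtain ⟨Q, hQ⟩ : X ^ (n + 1) ∣ K - (trunc (n + 1) K : ℂ⟦X⟧) := by
    rw [X_pow_dvd_iff]
    intro m hm
    simp [coeff_trunc, hm]
  have e : (K.subst (X * S) : ℂ⟦X⟧) =
      (∑ k ∈ Finset.range (n + 1), C (coeff k K) * (X * S) ^ k) +
        X ^ (n + 1) * (S ^ (n + 1) * Q.subst (X * S)) := by
    rw [← mul_assoc, ← mul_pow]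
    conv_lhs => rw [← sub_add_cancel K (trunc (n + 1) K : ℂ⟦X⟧), hQ, subst_add hS, subst_mul hS,
      subst_pow hS, subst_X hS, subst_coe hS, add_comm]
    congr 1
    rw [trunc_apply, map_sum, Nat.Ico_zero_eq_range]
    refine Finset.sum_congr rfl fun k _ => ?_
    rw [Polynomial.aeval_monomial]
    rfl
  rw [e, mul_add, mul_left_comm S (X ^ (n + 1)), map_add, coeff_X_pow_mul', if_neg (by omega),
    add_zero, Finset.mul_sum, map_sum]
  refine Finset.sum_congr rfl fun k _ => ?_
  rw [mul_left_comm, coeff_C_mul]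

theorem X_pow_dvd_map_mixture_sub {κ : Polynomial ℝ →ₗ[ℝ] ℝ} {K S : ℂ⟦X⟧}
    (hK : ∀ n, coeff n K = (κ (Polynomial.X ^ n) : ℂ)) {D : ℝ⟦X⟧} {n : ℕ}
    (h : X ^ n ∣ D.map Complex.ofRealHom - S) :
    X ^ n ∣ (mixture κ D).map Complex.ofRealHom - S * K.subst (X * S) := by
  rw [X_pow_dvd_iff]
  intro m hm
  rw [map_sub, coeff_mul_subst_X_mul, coeff_map, mixture, coeff_mk, map_sum,
    ← Finset.sum_sub_distrib]
  refine Finset.sum_eq_zero fun k _ => ?_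
  have hk : X ^ n ∣ (D * (X * D) ^ k).map Complex.ofRealHom - S * (X * S) ^ k := by
    have e : (D * (X * D) ^ k).map Complex.ofRealHom - S * (X * S) ^ k =
        X ^ k * (D.map Complex.ofRealHom ^ (k + 1) - S ^ (k + 1)) := by
      rw [map_mul, map_pow, map_mul, map_X]
      ring
    rw [e]
    exact (h.trans (sub_dvd_pow_sub_pow _ _ (k + 1))).mul_left _
  have := X_pow_dvd_iff.1 hk m hm
  rw [map_sub, coeff_map] at this
  rw [hK, map_mul]
  change (κ (Polynomial.X ^ k) : ℂ) * _ - _ = 0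
  linear_combination (κ (Polynomial.X ^ k) : ℂ) * this

/-- Approximations of the solution of `S = 1 + (α w + w² S K(w S)) S`. -/
noncomputable def momentIterate (α : ℝ) (κ : Polynomial ℝ →ₗ[ℝ] ℝ) : ℕ → ℝ⟦X⟧
  | 0 => 1
  | n + 1 => (1 - (C α * X + X ^ 2 * mixture κ (momentIterate α κ n)))⁻¹

theorem momentIterate_succ (α : ℝ) (κ : Polynomial ℝ →ₗ[ℝ] ℝ) (n : ℕ) :
    momentIterate α κ (n + 1) = 1 + (C α * X + X ^ 2 * mixture κ (momentIterate α κ n)) *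
      momentIterate α κ (n + 1) := by
  have h := PowerSeries.mul_inv_cancel
    (1 - (C α * X + X ^ 2 * mixture κ (momentIterate α κ n))) (by simp)
  rw [momentIterate]
  linear_combination h

theorem isPosDef_momentIterate (α : ℝ) {κ : Polynomial ℝ →ₗ[ℝ] ℝ}
    (hκ : ∀ p : Polynomial ℝ, (∀ x, 0 ≤ p.eval x) → 0 ≤ κ p) (n : ℕ) :
    IsPosDef (momentIterate α κ n) := by
  induction n with
  | zero => exact isPosDef_one
  | succ n ih => exact (ih.mixture hκ).coefficient_extension α (momentIterate_succ α κ n)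

/-- The mixture modulo wⁿ depends only on its argument modulo wⁿ, and the factor w² in front makes
each iteration gain precision. -/
theorem X_pow_dvd_momentIterate_sub (α : ℝ) {κ : Polynomial ℝ →ₗ[ℝ] ℝ} {K S : ℂ⟦X⟧}
    (hK : ∀ n, coeff n K = (κ (Polynomial.X ^ n) : ℂ))
    (hS : S = 1 + (C (α : ℂ) * X + X ^ 2 * (S * K.subst (X * S))) * S) (n : ℕ) :
    X ^ n ∣ (momentIterate α κ n).map Complex.ofRealHom - S := by
  induction n with
  | zero => simp
  | succ n ih =>
    obtain ⟨Q, hQ⟩ := X_pow_dvd_map_mixture_sub hK ih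
    have h := congrArg (PowerSeries.map Complex.ofRealHom) (momentIterate_succ α κ n)
    simp only [map_add, map_mul, map_pow, map_X, map_C, map_one] at h
    set T := (momentIterate α κ (n + 1)).map Complex.ofRealHom
    set Θ := (mixture κ (momentIterate α κ n)).map Complex.ofRealHom
    change T = 1 + (C (α : ℂ) * X + X ^ 2 * Θ) * T at h
    set H := C (α : ℂ) * X + X ^ 2 * Θ with hH
    have hinv := PowerSeries.inv_mul_cancel (1 - H) (by simp [hH])
    refine ⟨(1 - H)⁻¹ * X * Q * S, ?_⟩
    have e : (1 - H) * (T - S) = X ^ 2 * (X ^ n * Q) * S := by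
      rw [← hQ]
      linear_combination h - hS + S * hH
    linear_combination (1 - H)⁻¹ * e - (T - S) * hinv

theorem exists_isPosDef_map_eq (α : ℝ) {κ : Polynomial ℝ →ₗ[ℝ] ℝ}
    (hκ : ∀ p : Polynomial ℝ, (∀ x, 0 ≤ p.eval x) → 0 ≤ κ p) {K S : ℂ⟦X⟧}
    (hK : ∀ n, coeff n K = (κ (Polynomial.X ^ n) : ℂ))
    (hS : S = 1 + (C (α : ℂ) * X + X ^ 2 * (S * K.subst (X * S))) * S) :
    ∃ D : ℝ⟦X⟧, IsPosDef D ∧ S = D.map Complex.ofRealHom := by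
  have hc : ∀ n m, m < n → coeff m S = ((coeff m (momentIterate α κ n) : ℝ) : ℂ) := by
    intro n m hm
    have := X_pow_dvd_iff.1 (X_pow_dvd_momentIterate_sub α hK hS n) m hm
    rw [map_sub, coeff_map, sub_eq_zero] at this
    exact this.symm
  -- Agreement modulo wⁿ controls only the coefficients below n, hence the iterate n + 1 for the
  -- coefficient n.
  refine ⟨PowerSeries.mk fun n => coeff n (momentIterate α κ (n + 1)), ?_, ?_⟩
  · intro q
    refine (isPosDef_momentIterate α hκ ((q * q).natDegree + 1)).congr fun n hn => ?_
    have h1 := hc (n + 1) n (Nat.lt_succ_self n)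
    have h2 := hc ((q * q).natDegree + 1) n (Nat.lt_succ_of_le hn)
    rw [coeff_mk]
    exact_mod_cast h1.symm.trans h2
  · ext n
    rw [hc (n + 1) n (Nat.lt_succ_self n), coeff_map, coeff_mk]
    rfl

/-- A functional with free cumulant series `α z + z² K(z)`, where the coefficients of `K` are the
moments of a positive `κ`, has a positive definite moment series. -/
theorem exists_isPosDef_of_freeCumulantSeries {φ : Functional} (α : ℝ)
    {κ : Polynomial ℝ →ₗ[ℝ] ℝ} (hκ : ∀ p : Polynomial ℝ, (∀ x, 0 ≤ p.eval x) → 0 ≤ κ p)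
    {K : ℂ⟦X⟧} (hK : ∀ n, coeff n K = (κ (Polynomial.X ^ n) : ℂ))
    (hR : freeCumulantSeries φ = C (α : ℂ) * X + X ^ 2 * K) :
    ∃ D : ℝ⟦X⟧, IsPosDef D ∧ 1 + momentSeries φ = D.map Complex.ofRealHom := by
  refine exists_isPosDef_map_eq α hκ hK ?_
  have h := freeCumulantSeries_spec φ
  have hU := hasSubst_X_mul (1 + momentSeries φ)
  rw [hR] at h
  simp only [subst_add hU, subst_mul hU, subst_pow hU, subst_X hU, subst_const] at h
  linear_combination -h

/-- The form αz + z²K is stable under multiplication by t ≥ 0, with tα and tκ in place of α and κ.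
-/
theorem isFreelyInfinitelyDivisible_of_freeCumulantSeries {φ : Functional} (hφ : φ 1 = 1) (α : ℝ)
    {κ : Polynomial ℝ →ₗ[ℝ] ℝ} (hκ : ∀ p : Polynomial ℝ, (∀ x, 0 ≤ p.eval x) → 0 ≤ κ p)
    {K : ℂ⟦X⟧} (hK : ∀ n, coeff n K = (κ (Polynomial.X ^ n) : ℂ))
    (hR : freeCumulantSeries φ = C (α : ℂ) * X + X ^ 2 * K) :
    IsFreelyInfinitelyDivisible φ := by
  constructor
  · obtain ⟨D, hD, h⟩ := exists_isPosDef_of_freeCumulantSeries α hκ hK hR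
    exact isState_of_isPosDef hφ hD h
  · intro t ht
    obtain ⟨D, hD, h⟩ := exists_isPosDef_of_freeCumulantSeries (φ := freePow φ t) (t * α)
      (κ := t • κ) (fun p hp => mul_nonneg ht (hκ p hp)) (K := C (t : ℂ) * K)
      (by intro n; simp [hK]) (by
        rw [freeCumulantSeries_freePow, hR]
        push_cast
        rw [map_mul]
        ring)
    exact isState_of_isPosDef (ofFreeCumulantSeries_one _) hD h

/-! ### Free Meixner distributions and their Boolean cumulants -/

theorem map_C_mul (φ : Functional) (z : ℂ) (p : Polynomial ℂ) :
    φ (Polynomial.C z * p) = z * φ p := by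
  rw [← Polynomial.smul_eq_C_mul, map_smul, smul_eq_mul]

theorem coeff_succ_one_add_momentSeries (φ : Functional) (n : ℕ) :
    coeff (n + 1) (1 + momentSeries φ) = φ (Polynomial.X ^ (n + 1)) := by
  simp [momentSeries, coeff_one]

/-- The squared norm of the second orthogonal polynomial is vd. -/
theorem HasMeixnerCumulants.nonneg_of_isState {a v b d : ℝ} {φ : Functional}
    (h : HasMeixnerCumulants a v b d φ) (hφ : IsState φ) (hv : 0 < v) : 0 ≤ d := by
  obtain ⟨h1, G, hη, hG⟩ := h
  have hDη := mul_one_sub_booleanCumulantSeries φ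
  set D := 1 + momentSeries φ with hD
  have hG0 : coeff 0 G = 0 := by rw [hG]; simp
  have hGs : ∀ n, coeff (n + 1) G = coeff n (1 : ℂ⟦X⟧) + b * coeff n G + d * coeff n (G * G) := by
    intro n
    conv_lhs => rw [hG]
    rw [coeff_succ_X_mul, map_add, map_add, coeff_C_mul, coeff_C_mul, pow_two]
  have hG1 : coeff 1 G = 1 := by rw [hGs 0, coeff_mul]; simp [hG0, -coeff_zero_eq_constantCoeff]
  have hG2 : coeff 2 G = b := by
    rw [hGs 1, coeff_mul]
    simp [Finset.Nat.antidiagonal_succ, hG0, hG1, coeff_one, -coeff_zero_eq_constantCoeff]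
  have hG3 : coeff 3 G = b ^ 2 + d := by
    rw [hGs 2, coeff_mul]
    simp [Finset.Nat.antidiagonal_succ, hG0, hG1, hG2, coeff_one, -coeff_zero_eq_constantCoeff]
    ring
  have hD0 : coeff 0 D = 1 := by simp [hD, constantCoeff_momentSeries]
  have hDs : ∀ n, coeff (n + 1) D = a * coeff n D + v * coeff n (G * D) := by
    intro n
    have e : D = 1 + X * (C (a : ℂ) * D + C (v : ℂ) * (G * D)) := by
      rw [hη] at hDη
      linear_combination hDη
    conv_lhs => rw [e]
    rw [map_add, coeff_succ_X_mul, map_add, coeff_C_mul, coeff_C_mul]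
    simp [coeff_one]
  have hD1 : coeff 1 D = a := by
    rw [hDs 0, coeff_mul]; simp [hG0, hD0, -coeff_zero_eq_constantCoeff]
  have hD2 : coeff 2 D = a ^ 2 + v := by
    rw [hDs 1, coeff_mul]
    simp [Finset.Nat.antidiagonal_succ, hG0, hG1, hD0, hD1, -coeff_zero_eq_constantCoeff]
    ring
  have hD3 : coeff 3 D = a * (a ^ 2 + v) + v * (a + b) := by
    rw [hDs 2, coeff_mul]
    simp [Finset.Nat.antidiagonal_succ, hG0, hG1, hG2, hD0, hD1, hD2,
      -coeff_zero_eq_constantCoeff]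
  have hD4 : coeff 4 D = a * (a * (a ^ 2 + v) + v * (a + b)) +
      v * (a ^ 2 + v + b * a + b ^ 2 + d) := by
    rw [hDs 3, coeff_mul]
    simp [Finset.Nat.antidiagonal_succ, hG0, hG1, hG2, hG3, hD0, hD1, hD2, hD3,
      -coeff_zero_eq_constantCoeff]
    left
    ring
  have hm1 : φ (Polynomial.X ^ 1) = a := by rw [← hD1, hD, coeff_succ_one_add_momentSeries]
  have hm2 := (coeff_succ_one_add_momentSeries φ 1).symm.trans hD2
  have hm3 := (coeff_succ_one_add_momentSeries φ 2).symm.trans hD3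
  have hm4 := (coeff_succ_one_add_momentSeries φ 3).symm.trans hD4
  norm_num at hm2 hm3 hm4
  -- This is P₂ = (x − b)(x − a) − v.
  let p : Polynomial ℂ := Polynomial.X ^ 2 - Polynomial.C ((a + b : ℝ) : ℂ) * Polynomial.X +
    Polynomial.C ((a * b - v : ℝ) : ℂ)
  have hp : p.map (starRingEnd ℂ) = p := by
    simp only [p, Polynomial.map_add, Polynomial.map_sub, Polynomial.map_mul, Polynomial.map_pow,
      Polynomial.map_X, Polynomial.map_C, Complex.conj_ofReal]
  have hpp : p * p = Polynomial.X ^ 4 - Polynomial.C ((2 * (a + b) : ℝ) : ℂ) * Polynomial.X ^ 3 +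
      Polynomial.C (((a + b) ^ 2 + 2 * (a * b - v) : ℝ) : ℂ) * Polynomial.X ^ 2 -
      Polynomial.C ((2 * (a + b) * (a * b - v) : ℝ) : ℂ) * Polynomial.X ^ 1 +
      Polynomial.C (((a * b - v) ^ 2 : ℝ) : ℂ) * 1 := by
    simp only [p]
    push_cast
    simp only [map_add, map_sub, map_mul, map_pow, map_ofNat]
    ring
  have hval : φ (p * p) = ((v * d : ℝ) : ℂ) := by
    rw [hpp]
    simp only [map_add, map_sub, map_C_mul, hm1, hm2, hm3, hm4, h1]
    push_cast
    ring
  have := hφ.nonneg p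
  rw [hp, hval, Complex.ofReal_re] at this
  exact nonneg_of_mul_nonneg_right this hv

/-! ### Jacobi parameters and the three-term recursion -/

theorem X_mul_jacobiPolynomial_zero (β γ : ℕ → ℝ) :
    Polynomial.X * jacobiPolynomial β γ 0 = jacobiPolynomial β γ 1 +
      Polynomial.C (β 0 : ℂ) * jacobiPolynomial β γ 0 := by
  simp [jacobiPolynomial]

theorem X_mul_jacobiPolynomial_succ (β γ : ℕ → ℝ) (n : ℕ) :
    Polynomial.X * jacobiPolynomial β γ (n + 1) = jacobiPolynomial β γ (n + 2) +
      Polynomial.C (β (n + 1) : ℂ) * jacobiPolynomial β γ (n + 1) +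
      Polynomial.C (γ (n + 1) : ℂ) * jacobiPolynomial β γ n := by
  rw [jacobiPolynomial]
  ring

/-- A functional which annihilates all `Pₙ` with `n ≥ 1` is orthogonal. -/
theorem hasJacobiParameters_of_apply_eq_zero {φ : Functional} {β γ : ℕ → ℝ}
    (h : ∀ n, φ (jacobiPolynomial β γ (n + 1)) = 0) : HasJacobiParameters φ β γ := by
  -- Induction on two consecutive indices: the recursion writes P_{m+2} through xP_{m+1}, P_{m+1}
  -- and P_m, and `step` moves the factor x over to the other polynomial.
  have key : ∀ m, (∀ n, m < n → φ (jacobiPolynomial β γ m * jacobiPolynomial β γ n) = 0) ∧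
      ∀ n, m + 1 < n → φ (jacobiPolynomial β γ (m + 1) * jacobiPolynomial β γ n) = 0 := by
    intro m
    have step : ∀ n (q : Polynomial ℂ), φ (q * jacobiPolynomial β γ (n + 2)) = 0 →
        φ (q * jacobiPolynomial β γ (n + 1)) = 0 → φ (q * jacobiPolynomial β γ n) = 0 →
        φ (Polynomial.X * q * jacobiPolynomial β γ (n + 1)) = 0 := by
      intro n q h2 h1 h0
      rw [mul_comm Polynomial.X, mul_assoc, X_mul_jacobiPolynomial_succ, mul_add, mul_add,
        mul_left_comm q, mul_left_comm q, map_add, map_add, map_C_mul, map_C_mul, h0, h1, h2]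
      simp
    have hzero : ∀ n, 0 < n → φ (jacobiPolynomial β γ 0 * jacobiPolynomial β γ n) = 0 := by
      intro n hn
      obtain ⟨n, rfl⟩ := Nat.exists_eq_succ_of_ne_zero hn.ne'
      rw [jacobiPolynomial, one_mul, h]
    induction m with
    | zero =>
      refine ⟨hzero, fun n hn => ?_⟩
      obtain ⟨n, rfl⟩ : ∃ k, n = k + 2 := ⟨n - 2, by omega⟩
      have e : jacobiPolynomial β γ (0 + 1) * jacobiPolynomial β γ (n + 2) =
          Polynomial.X * jacobiPolynomial β γ 0 * jacobiPolynomial β γ (n + 1 + 1) -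
          Polynomial.C (β 0 : ℂ) * (jacobiPolynomial β γ 0 * jacobiPolynomial β γ (n + 2)) := by
        rw [X_mul_jacobiPolynomial_zero]
        ring
      rw [e, map_sub, map_C_mul, hzero _ (by omega),
        step _ _ (hzero _ (by omega)) (hzero _ (by omega)) (hzero _ (by omega))]
      simp
    | succ m ih =>
      refine ⟨ih.2, fun n hn => ?_⟩
      obtain ⟨n, rfl⟩ : ∃ k, n = k + 2 := ⟨n - 2, by omega⟩
      have e : jacobiPolynomial β γ (m + 1 + 1) * jacobiPolynomial β γ (n + 2) =
          Polynomial.X * jacobiPolynomial β γ (m + 1) * jacobiPolynomial β γ (n + 1 + 1) -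
          Polynomial.C (β (m + 1) : ℂ) *
            (jacobiPolynomial β γ (m + 1) * jacobiPolynomial β γ (n + 2)) -
          Polynomial.C (γ (m + 1) : ℂ) *
            (jacobiPolynomial β γ m * jacobiPolynomial β γ (n + 2)) := by
        rw [X_mul_jacobiPolynomial_succ]
        ring
      rw [e, map_sub, map_sub, map_C_mul, map_C_mul, ih.1 _ (by omega), ih.2 _ (by omega),
        step _ _ (ih.2 _ (by omega)) (ih.2 _ (by omega)) (ih.2 _ (by omega))]
      simp
  intro m n hmn
  rcases lt_or_gt_of_ne hmn with h' | h'
  · exact (key m).1 n h'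
  · rw [mul_comm]
    exact (key n).1 m h'

/-- A unital functional is determined by its Jacobi parameters. -/
theorem HasJacobiParameters.unique {φ ψ : Functional} {β γ : ℕ → ℝ}
    (hφ : HasJacobiParameters φ β γ) (hψ : HasJacobiParameters ψ β γ) (hφ1 : φ 1 = 1)
    (hψ1 : ψ 1 = 1) : φ = ψ := by
  have h0 : ∀ n, φ (jacobiPolynomial β γ n) = ψ (jacobiPolynomial β γ n) := by
    intro n
    rcases n with _ | n
    · rw [jacobiPolynomial, hφ1, hψ1]
    · have h1 := hφ 0 (n + 1) (by omega)
      have h2 := hψ 0 (n + 1) (by omega)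
      rw [jacobiPolynomial, one_mul] at h1 h2
      rw [h1, h2]
  have h : ∀ k n, φ (Polynomial.X ^ k * jacobiPolynomial β γ n) =
      ψ (Polynomial.X ^ k * jacobiPolynomial β γ n) := by
    intro k
    induction k with
    | zero => intro n; simpa using h0 n
    | succ k ih =>
      intro n
      rw [pow_succ, mul_assoc]
      rcases n with _ | n
      · rw [X_mul_jacobiPolynomial_zero, mul_add, mul_left_comm, map_add, map_add, map_C_mul,
          map_C_mul, ih, ih]
      · rw [X_mul_jacobiPolynomial_succ, mul_add, mul_add, mul_left_comm, map_add, map_add,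
          map_add, map_add, mul_left_comm _ (Polynomial.C _) (jacobiPolynomial β γ n), map_C_mul,
          map_C_mul, map_C_mul, map_C_mul, ih, ih, ih]
  refine eq_of_momentSeries_eq hφ1 hψ1 ?_
  ext n
  have := h n 0
  rw [jacobiPolynomial, mul_one] at this
  simp only [momentSeries, coeff_mk, this]

/-- The series S_n = ∑ φ(x^k P_n) w^k inherit the three-term recursion, solved by S_n = (1 +
c)^{n−1} (1 + M) Gⁿ for n ≥ 1. As G(0) = 0, φ(P_n) = 0. -/
theorem HasMeixnerCumulants.hasJacobiParameters {b c : ℝ} {φ : Functional}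
    (h : HasMeixnerCumulants 0 1 b (1 + c) φ) :
    HasJacobiParameters φ (fun n => if n = 0 then 0 else b)
      (fun n => if n = 1 then 1 else 1 + c) := by
  obtain ⟨h1, G, hη, hG⟩ := h
  have hDη := mul_one_sub_booleanCumulantSeries φ
  rw [hη] at hDη
  simp only [Complex.ofReal_zero, map_zero, Complex.ofReal_one, map_one, zero_add, one_mul] at hDη
  set β : ℕ → ℝ := fun n => if n = 0 then 0 else b with hβ
  set γ : ℕ → ℝ := fun n => if n = 1 then 1 else 1 + c with hγ
  set D := 1 + momentSeries φ with hD
  let S : ℕ → ℂ⟦X⟧ := fun n =>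
    PowerSeries.mk fun k => φ (Polynomial.X ^ k * jacobiPolynomial β γ n)
  have hS0 : S 0 = D := by
    ext n
    rcases n with _ | n
    · simp [S, D, jacobiPolynomial, h1, constantCoeff_momentSeries]
    · rw [hD, coeff_succ_one_add_momentSeries]
      simp [S, jacobiPolynomial]
  have hconst : ∀ n, constantCoeff (S n) = φ (jacobiPolynomial β γ n) := by
    intro n
    simp [S, ← coeff_zero_eq_constantCoeff_apply]
  have hrec0 : S 0 = C (constantCoeff (S 0)) + X * S 1 := by
    ext n
    rcases n with _ | n
    · simp
    · rw [map_add, coeff_succ_X_mul]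
      simp only [S, coeff_mk, coeff_C, Nat.succ_ne_zero, if_false, zero_add]
      rw [pow_succ, mul_assoc, X_mul_jacobiPolynomial_zero]
      simp [hβ]
  have hrec : ∀ n, S (n + 1) = C (constantCoeff (S (n + 1))) +
      X * (S (n + 2) + C (b : ℂ) * S (n + 1) + C (γ (n + 1) : ℂ) * S n) := by
    intro n
    ext k
    rcases k with _ | k
    · simp
    · rw [map_add, coeff_succ_X_mul, map_add, map_add, coeff_C_mul, coeff_C_mul]
      simp only [S, coeff_mk, coeff_C, Nat.succ_ne_zero, if_false, zero_add]
      rw [pow_succ, mul_assoc, X_mul_jacobiPolynomial_succ, mul_add, mul_add, mul_left_comm,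
        map_add, map_add, mul_left_comm _ (Polynomial.C _) (jacobiPolynomial β γ n), map_C_mul,
        map_C_mul]
      simp [hβ]
  have hG0 : constantCoeff G = 0 := by rw [hG]; simp
  have hS1 : S 1 = D * G := by
    apply mul_left_cancel₀ (X_ne_zero (R := ℂ))
    have e : constantCoeff (S 0) = 1 := by rw [hconst, jacobiPolynomial, h1]
    rw [e, map_one, hS0] at hrec0
    linear_combination hDη - hrec0
  have hSn : ∀ n, S (n + 1) = C ((1 + c : ℝ) : ℂ) ^ n * (D * G ^ (n + 1)) ∧
      S (n + 2) = C ((1 + c : ℝ) : ℂ) ^ (n + 1) * (D * G ^ (n + 2)) := by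
    intro n
    induction n with
    | zero =>
      refine ⟨by simp [hS1], ?_⟩
      apply mul_left_cancel₀ (X_ne_zero (R := ℂ))
      have e := hrec 0
      have e0 : constantCoeff (S 1) = 0 := by rw [hS1, map_mul, hG0, mul_zero]
      rw [zero_add, e0, map_zero] at e
      simp only [zero_add, hS1, hS0, hγ, if_true, Complex.ofReal_one, map_one] at e ⊢
      linear_combination D * hG - e
    | succ n ih =>
      refine ⟨ih.2, ?_⟩
      apply mul_left_cancel₀ (X_ne_zero (R := ℂ))
      have e := hrec (n + 1)
      have e0 : constantCoeff (S (n + 2)) = 0 := by rw [ih.2]; simp [hG0]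
      have eγ : γ (n + 1 + 1) = 1 + c := by simp [hγ]
      rw [e0, map_zero, ih.1, ih.2, eγ] at e
      linear_combination C ((1 + c : ℝ) : ℂ) ^ (n + 1) * D * G ^ (n + 1) * hG - e
  refine hasJacobiParameters_of_apply_eq_zero fun n => ?_
  rw [← hconst, (hSn n).1]
  simp [hG0]

/-- F = G/w solves F = 1 + (bw + dw²F)F, so it is the moment series of a semicircular law of mean b
and variance d, with κ = d δ₀. Then 1 + M = (1 − w²F)⁻¹ is a coefficient extension. -/
theorem HasMeixnerCumulants.isState {b d : ℝ} (hd : 0 ≤ d) {φ : Functional}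
    (h : HasMeixnerCumulants 0 1 b d φ) : IsState φ := by
  obtain ⟨h1, G, hη, hG⟩ := h
  have hDη := mul_one_sub_booleanCumulantSeries φ
  rw [hη] at hDη
  simp only [Complex.ofReal_zero, map_zero, Complex.ofReal_one, map_one, zero_add, one_mul] at hDη
  set F := 1 + C (b : ℂ) * G + C (d : ℂ) * G ^ 2 with hF
  let κ : Polynomial ℝ →ₗ[ℝ] ℝ := d • Polynomial.leval 0
  obtain ⟨E, hE, hFE⟩ := exists_isPosDef_map_eq b (κ := κ) (K := C (d : ℂ)) (S := F)
    (fun p hp => mul_nonneg hd (hp 0))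
    (by
      intro n
      rcases n with _ | n
      · simp [κ]
      · simp [κ])
    (by
      rw [subst_const]
      conv_lhs => rw [hF, hG]
      ring)
  have hinv := PowerSeries.mul_inv_cancel (1 - X ^ 2 * E) (by simp)
  refine isState_of_isPosDef h1 (D := (1 - X ^ 2 * E)⁻¹) ?_ ?_
  · refine hE.coefficient_extension 0 ?_
    rw [map_zero]
    linear_combination hinv
  · have hinv' := congrArg (PowerSeries.map Complex.ofRealHom) hinv
    simp only [map_mul, map_sub, map_one, map_pow, map_X, ← hFE] at hinv'
    rw [hG] at hDη
    linear_combination (map Complex.ofRealHom (1 - X ^ 2 * E)⁻¹) * hDη - (1 + momentSeries φ) * hinv'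

theorem hasMeixnerCumulants_ofBooleanCumulantSeries {a v b d : ℝ} {G : ℂ⟦X⟧}
    (hG : G = X * (1 + C (b : ℂ) * G + C (d : ℂ) * G ^ 2)) :
    HasMeixnerCumulants a v b d
      (ofBooleanCumulantSeries (X * (C (a : ℂ) + C (v : ℂ) * G))) :=
  ⟨ofBooleanCumulantSeries_one _, G,
    booleanCumulantSeries_ofBooleanCumulantSeries (by simp), hG⟩

/-- G is w(1 + M) for the functional with free cumulant series bz + dz². -/
theorem exists_hasMeixnerCumulants (a v b d : ℝ) : ∃ φ, HasMeixnerCumulants a v b d φ := by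
  let φ := ofFreeCumulantSeries (C (b : ℂ) * X + C (d : ℂ) * X ^ 2)
  have h := ofFreeCumulantSeries_equation (R := C (b : ℂ) * X + C (d : ℂ) * X ^ 2) (by simp)
  change momentSeries φ = PowerSeries.subst (X * (1 + momentSeries φ)) _ at h
  have hU := hasSubst_X_mul (1 + momentSeries φ)
  simp only [subst_add hU, subst_mul hU, subst_pow hU, subst_X hU, subst_const] at h
  refine ⟨_, hasMeixnerCumulants_ofBooleanCumulantSeries (G := X * (1 + momentSeries φ)) ?_⟩
  linear_combination X * h

theorem isNormalizedFreeMeixner_iff {φ : Functional} :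
    IsNormalizedFreeMeixner φ ↔ ∃ b d : ℝ, 0 ≤ d ∧ HasMeixnerCumulants 0 1 b d φ := by
  constructor
  · rintro ⟨b, c, hc, hφ, hJ⟩
    obtain ⟨ψ, hψ⟩ := exists_hasMeixnerCumulants 0 1 b (1 + c)
    have : φ = ψ := hJ.unique hψ.hasJacobiParameters hφ.map_one hψ.1
    exact ⟨b, 1 + c, hc, this ▸ hψ⟩
  · rintro ⟨b, d, hd, h⟩
    refine ⟨b, d - 1, by simpa using hd, h.isState hd, ?_⟩
    exact HasMeixnerCumulants.hasJacobiParameters (by simpa using h)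

theorem isFreeMeixner_iff {φ : Functional} :
    IsFreeMeixner φ ↔ ∃ a v b d : ℝ, 0 < v ∧ 0 ≤ d ∧ HasMeixnerCumulants a v b d φ := by
  constructor
  · rintro ⟨μ, v, a, hμ, hv, rfl⟩
    obtain ⟨b, d, hd, -, G, hη, hG⟩ := isNormalizedFreeMeixner_iff.1 hμ
    refine ⟨a, v, b, d, hv, hd, ofBooleanCumulantSeries_one _, G, ?_, hG⟩
    rw [booleanCumulantSeries_booleanConv, booleanCumulantSeries_booleanPow,
      booleanCumulantSeries_dirac, hη]
    simp only [Complex.ofReal_zero, map_zero, Complex.ofReal_one, map_one]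
    ring
  · rintro ⟨a, v, b, d, hv, hd, h1, G, hη, hG⟩
    have hμ : HasMeixnerCumulants 0 1 b d _ := hasMeixnerCumulants_ofBooleanCumulantSeries hG
    refine ⟨_, v, a, isNormalizedFreeMeixner_iff.2 ⟨b, d, hd, hμ⟩, hv, ?_⟩
    refine eq_of_booleanCumulantSeries_eq h1 (ofBooleanCumulantSeries_one _) ?_
    rw [booleanCumulantSeries_booleanConv, booleanCumulantSeries_booleanPow,
      booleanCumulantSeries_dirac, hη,
      booleanCumulantSeries_ofBooleanCumulantSeries (by simp)]
    simp only [Complex.ofReal_zero, map_zero, Complex.ofReal_one, map_one]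
    ring

/-! ### The c-free evolution of free Meixner distributions -/

theorem eq_freeConv_freePow_dirac_iff {ρ ψ : Functional} (hψ : ψ 1 = 1) {s α : ℝ} :
    ψ = freeConv (freePow ρ s) (dirac α) ↔
      freeCumulantSeries ψ = C (s : ℂ) * freeCumulantSeries ρ + C (α : ℂ) * X := by
  have h : freeCumulantSeries (freeConv (freePow ρ s) (dirac α)) =
      C (s : ℂ) * freeCumulantSeries ρ + C (α : ℂ) * X := by
    rw [freeCumulantSeries_freeConv, freeCumulantSeries_freePow, freeCumulantSeries_dirac]
  rw [← h]
  exact ⟨fun e => by rw [e],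
    fun e => eq_of_freeCumulantSeries_eq hψ (ofFreeCumulantSeries_one _) e⟩

/-- The same a and v occur for ρ as for Φ[ρ,ψ]; with a = 0, v = 1 this yields the normalized
statement. -/
theorem HasMeixnerCumulants.of_evolution {ρ ψ : Functional} (hρ : ρ 1 = 1) (hψ : ψ 1 = 1)
    {a v b d : ℝ} (hv : 0 < v) (h : HasMeixnerCumulants a v b d (Phi ρ ψ))
    (ht : ∀ t : ℝ, 0 < t → IsFreeMeixner (Phi (freePow ρ t) (freePow ψ t))) :
    (∃ b' d' : ℝ, 0 ≤ d' ∧ HasMeixnerCumulants a v b' d' ρ) ∧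
      ∃ s α : ℝ, -1 ≤ s ∧ ψ = freeConv (freePow ρ (1 + s)) (dirac α) := by
  simp only [hasMeixnerCumulants_iff hρ, eq_freeConv_freePow_dirac_iff hψ]
  refine (hasMeixnerCumulants_Phi_iff.1 h).of_evolution (constantCoeff_freeCumulantSeries ψ) hv
    fun t htpos => ?_
  obtain ⟨a', v', b', d', hv', hd', h'⟩ := isFreeMeixner_iff.1 (ht t htpos)
  rw [hasMeixnerCumulants_Phi_iff, freeCumulantSeries_freePow, freeCumulantSeries_freePow] at h'
  exact ⟨a', v', b', d', hv', hd', h'⟩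

theorem IsFreeMeixner.evolution {ρ ψ : Functional} (hρ : IsFreelyInfinitelyDivisible ρ)
    (hψ : ψ 1 = 1) (h : IsFreeMeixner ρ) {s α : ℝ} (hs : -1 ≤ s)
    (hρψ : ψ = freeConv (freePow ρ (1 + s)) (dirac α)) {t : ℝ} (ht : 0 < t) :
    IsFreeMeixner (Phi (freePow ρ t) (freePow ψ t)) := by
  obtain ⟨a, v, b, d, hv, -, h⟩ := isFreeMeixner_iff.1 h
  have hpair := (hasMeixnerCumulants_iff hρ.1.map_one).1 h
  -- For ρ^{⊞r} the quadratic coefficient is d − v + rv, which must be nonnegative for a state. If d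
  -- < v, this r makes it (d − v)/2.
  have hd : v ≤ d := by
    by_contra! hlt
    have hr : 0 < (v - d) / (2 * v) := div_pos (by linarith) (by linarith)
    have h1 := hpair.evolution (s := 0) (α := 0) (S := freeCumulantSeries ρ) (by simp)
      ((v - d) / (2 * v))
    rw [← freeCumulantSeries_freePow] at h1
    have h2 := ((hasMeixnerCumulants_iff (ofFreeCumulantSeries_one _)).2 h1).nonneg_of_isState (hρ.2 _ hr.le) (mul_pos hr hv)
    have h3 : (v - d) / (2 * v) * ((1 + 0) * v) = (v - d) / 2 := by
      field_simp
      ring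
    linarith
  have h1 := hpair.evolution ((eq_freeConv_freePow_dirac_iff hψ).1 hρψ) t
  rw [← freeCumulantSeries_freePow, ← freeCumulantSeries_freePow,
    ← hasMeixnerCumulants_Phi_iff] at h1
  have hs' : 0 ≤ t * ((1 + s) * v) := mul_nonneg ht.le (mul_nonneg (by linarith) hv.le)
  exact isFreeMeixner_iff.2 ⟨_, _, _, _, mul_pos ht hv, by linarith, h1⟩

theorem IsNormalizedFreeMeixner.isFreeMeixner {φ : Functional} (h : IsNormalizedFreeMeixner φ) :
    IsFreeMeixner φ := by
  obtain ⟨b, d, hd, h⟩ := isNormalizedFreeMeixner_iff.1 h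
  exact isFreeMeixner_iff.2 ⟨0, 1, b, d, one_pos, hd, h⟩

/-- The free cumulant series of δ₀ vanishes, so g, b and d stay fixed while a and v scale by t. -/
theorem IsFreeMeixner.boolean_evolution {ρ : Functional} (h : IsFreeMeixner (Phi ρ (dirac 0)))
    {t : ℝ} (ht : 0 < t) : IsFreeMeixner (Phi (freePow ρ t) (freePow (dirac 0) t)) := by
  obtain ⟨a, v, b, d, hv, hd, h⟩ := isFreeMeixner_iff.1 h
  obtain ⟨g, hR, hg⟩ := hasMeixnerCumulants_Phi_iff.1 h
  refine isFreeMeixner_iff.2 ⟨t * a, t * v, b, d, mul_pos ht hv, hd,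
    hasMeixnerCumulants_Phi_iff.2 ⟨g, ?_, ?_⟩⟩
  · rw [freeCumulantSeries_freePow, hR]
    push_cast
    simp only [map_mul]
    ring
  · rw [freeCumulantSeries_freePow]
    rw [freeCumulantSeries_dirac] at hg ⊢
    simpa using hg

/-! ### An evolution which leaves the free Meixner class -/

/-- The arcsine distribution on `[-2, 2]`. -/
noncomputable def arcsine : Polynomial ℝ →ₗ[ℝ] ℝ where
  toFun p := (2 * Real.pi)⁻¹ * ∫ θ in (0 : ℝ)..2 * Real.pi, p.eval (2 * Real.cos θ)
  map_add' p q := by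
    simp only [Polynomial.eval_add]
    rw [intervalIntegral.integral_add, mul_add] <;>
      exact Continuous.intervalIntegrable (by fun_prop) _ _
  map_smul' r p := by
    simp only [Polynomial.eval_smul, smul_eq_mul, intervalIntegral.integral_const_mul,
      RingHom.id_apply]
    ring

theorem arcsine_nonneg {p : Polynomial ℝ} (hp : ∀ x, 0 ≤ p.eval x) : 0 ≤ arcsine p := by
  refine mul_nonneg (by positivity) ?_
  exact intervalIntegral.integral_nonneg (by positivity) fun θ _ => hp _

theorem arcsine_X_pow (n : ℕ) : arcsine (Polynomial.X ^ n) =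
    (2 * Real.pi)⁻¹ * (2 ^ n * ∫ θ in (0 : ℝ)..2 * Real.pi, Real.cos θ ^ n) := by
  simp [arcsine, mul_pow]

theorem arcsine_one : arcsine (Polynomial.X ^ 0) = 1 := by
  rw [arcsine_X_pow]
  have := Real.pi_ne_zero
  simp
  field_simp

theorem arcsine_X : arcsine (Polynomial.X ^ 1) = 0 := by
  rw [arcsine_X_pow]
  simp

/-- Wallis' reduction formula; the boundary terms vanish over a full period. -/
theorem arcsine_X_pow_add_two (n : ℕ) :
    (n + 2) * arcsine (Polynomial.X ^ (n + 2)) = 4 * (n + 1) * arcsine (Polynomial.X ^ n) := by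
  rw [arcsine_X_pow, arcsine_X_pow, integral_cos_pow]
  simp only [Real.sin_two_pi, Real.sin_zero, mul_zero, sub_zero, zero_div, zero_add]
  have : (n : ℝ) + 2 ≠ 0 := by positivity
  field_simp
  ring

/-- The moment series of the arcsine distribution, `(1 - 4 z²)^{-1/2}`. -/
noncomputable def arcsineSeries : ℂ⟦X⟧ :=
  PowerSeries.mk fun n => (arcsine (Polynomial.X ^ n) : ℂ)

theorem coeff_arcsineSeries (n : ℕ) :
    coeff n arcsineSeries = (arcsine (Polynomial.X ^ n) : ℂ) := coeff_mk _ _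

theorem coeff_zero_arcsineSeries : coeff 0 arcsineSeries = 1 := by
  rw [coeff_arcsineSeries, arcsine_one, Complex.ofReal_one]

theorem coeff_one_arcsineSeries : coeff 1 arcsineSeries = 0 := by
  rw [coeff_arcsineSeries, arcsine_X, Complex.ofReal_zero]

theorem coeff_add_two_arcsineSeries (n : ℕ) :
    (n + 2) * coeff (n + 2) arcsineSeries = 4 * (n + 1) * coeff n arcsineSeries := by
  rw [coeff_arcsineSeries, coeff_arcsineSeries]
  exact_mod_cast congrArg ((↑) : ℝ → ℂ) (arcsine_X_pow_add_two n)

theorem coeff_two_arcsineSeries : coeff 2 arcsineSeries = 2 := by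
  have := coeff_add_two_arcsineSeries 0
  rw [coeff_zero_arcsineSeries] at this
  norm_num at this
  linear_combination this / 2

theorem coeff_four_arcsineSeries : coeff 4 arcsineSeries = 6 := by
  have := coeff_add_two_arcsineSeries 2
  rw [coeff_two_arcsineSeries] at this
  norm_num at this
  linear_combination this / 4

/-- The moment recursion as the differential equation (1 − 4z²)A' = 4zA. -/
theorem derivative_arcsineSeries :
    d⁄dX ℂ arcsineSeries = X * (4 * arcsineSeries + 4 * (X * d⁄dX ℂ arcsineSeries)) := by
  have h4 : (4 : ℂ⟦X⟧) = C 4 := (map_ofNat C 4).symm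
  ext n
  rw [h4]
  rcases n with _ | _ | n
  · rw [coeff_zero_X_mul, coeff_derivative, zero_add, coeff_one_arcsineSeries, zero_mul]
  · rw [coeff_succ_X_mul, map_add, coeff_C_mul, coeff_C_mul, coeff_zero_X_mul, coeff_derivative]
    have := coeff_add_two_arcsineSeries 0
    push_cast at this ⊢
    linear_combination this
  · rw [coeff_succ_X_mul, map_add, coeff_C_mul, coeff_C_mul, coeff_succ_X_mul, coeff_derivative,
      coeff_derivative]
    have := coeff_add_two_arcsineSeries (n + 1)
    push_cast at this ⊢
    linear_combination this

/-- By the differential equation both sides have the same derivative; their constant terms agree. -/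
theorem arcsineSeries_sq : arcsineSeries ^ 2 = 1 + 4 * (X * arcsineSeries) ^ 2 := by
  have h : arcsineSeries * arcsineSeries = 1 + C 4 * (X * arcsineSeries) * (X * arcsineSeries) := by
    refine derivative.ext ?_ ?_
    · have h4 : (C 4 : ℂ⟦X⟧) = 4 := map_ofNat C 4
      have := derivative_arcsineSeries
      simp only [map_add, Derivation.leibniz, derivative_C, derivative_X, derivative_one,
        smul_eq_mul] at this ⊢
      rw [h4]
      linear_combination 2 * arcsineSeries * this
    · have := coeff_zero_arcsineSeries
      rw [coeff_zero_eq_constantCoeff_apply] at this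
      simp [this]
  rw [show (C 4 : ℂ⟦X⟧) = 4 from map_ofNat C 4] at h
  linear_combination h

theorem exists_not_isFreeMeixner : ∃ ρ ψ : Functional,
    IsFreelyInfinitelyDivisible ρ ∧ IsFreelyInfinitelyDivisible ψ ∧
      IsNormalizedFreeMeixner (Phi ρ ψ) ∧
      ∃ t : ℝ, 0 < t ∧ ¬ IsFreeMeixner (Phi (freePow ρ t) (freePow ψ t)) := by
  let ρ := ofFreeCumulantSeries (X ^ 2 * arcsineSeries)
  let ψ := ofFreeCumulantSeries (arcsineSeries - 1)
  have h0 : constantCoeff arcsineSeries = 1 := by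
    rw [← coeff_zero_eq_constantCoeff_apply, coeff_zero_arcsineSeries]
  have hRρ : freeCumulantSeries ρ = X ^ 2 * arcsineSeries :=
    freeCumulantSeries_ofFreeCumulantSeries (by simp)
  have hRψ : freeCumulantSeries ψ = arcsineSeries - 1 :=
    freeCumulantSeries_ofFreeCumulantSeries (by simp [h0])
  have hφ : HasMeixnerCumulants 0 1 0 4 (Phi ρ ψ) := by
    refine hasMeixnerCumulants_Phi_iff.2 ⟨X * arcsineSeries, ?_, ?_⟩
    · rw [hRρ]
      simp only [Complex.ofReal_zero, map_zero, Complex.ofReal_one, map_one]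
      ring
    · rw [hRψ]
      push_cast
      rw [map_zero, map_ofNat]
      linear_combination X * arcsineSeries_sq
  refine ⟨ρ, ψ, ?_, ?_, isNormalizedFreeMeixner_iff.2 ⟨0, 4, by norm_num, hφ⟩, ?_⟩
  · refine isFreelyInfinitelyDivisible_of_freeCumulantSeries (ofFreeCumulantSeries_one _) 0
      (fun p => arcsine_nonneg) coeff_arcsineSeries ?_
    rw [hRρ]
    simp
  -- As A = 1 + O(z²), A − 1 = z²K, where K is the moment series of x² times the arcsine law.
  · refine isFreelyInfinitelyDivisible_of_freeCumulantSeries (ofFreeCumulantSeries_one _) 0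
      (κ := arcsine ∘ₗ LinearMap.mulLeft ℝ (Polynomial.X ^ 2))
      (K := PowerSeries.mk fun n => coeff (n + 2) arcsineSeries) ?_ ?_ ?_
    · intro p hp
      refine arcsine_nonneg fun x => ?_
      rw [LinearMap.mulLeft_apply, Polynomial.eval_mul, Polynomial.eval_pow, Polynomial.eval_X]
      exact mul_nonneg (sq_nonneg x) (hp x)
    · intro n
      rw [coeff_mk, coeff_arcsineSeries, LinearMap.comp_apply, LinearMap.mulLeft_apply, ← pow_add,
        add_comm]
    · rw [hRψ, Complex.ofReal_zero, map_zero, zero_mul, zero_add]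
      ext n
      rw [coeff_X_pow_mul']
      rcases n with _ | _ | n
      · simp [h0]
      · simp [coeff_one_arcsineSeries, coeff_one]
      · simp [coeff_one]
  -- Otherwise A − 1 = (1 + s)z²A + αz, whose coefficients of z² and z⁴ give 2 = 1 + s and 6 = 2(1 +
  -- s).
  · by_contra! hall
    obtain ⟨-, s, α, -, h⟩ := hφ.of_evolution (ofFreeCumulantSeries_one _)
      (ofFreeCumulantSeries_one _) one_pos hall
    rw [eq_freeConv_freePow_dirac_iff (ofFreeCumulantSeries_one _), hRρ, hRψ] at h
    have h2 := congrArg (coeff 2) h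
    have h4 := congrArg (coeff 4) h
    rw [map_sub, map_add, coeff_C_mul, coeff_C_mul, coeff_X_pow_mul'] at h2 h4
    simp only [le_refl, if_true, Nat.sub_self, coeff_zero_arcsineSeries, coeff_two_arcsineSeries,
      coeff_one, coeff_X] at h2
    simp only [show 2 ≤ 4 by norm_num, if_true, show 4 - 2 = 2 by norm_num,
      coeff_four_arcsineSeries, coeff_two_arcsineSeries, coeff_one, coeff_X] at h4
    norm_num at h2 h4
    have : (2 : ℂ) = 0 := by linear_combination h4 - 2 * h2
    norm_num at this

end CFree

open CFree in
theorem mainTheorem7 :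
    -- the characterization, for an un-normalized free Meixner `Φ[ρ, ψ]`
    (∀ ρ ψ : Functional,
      IsFreelyInfinitelyDivisible ρ → IsFreelyInfinitelyDivisible ψ → IsFreeMeixner (Phi ρ ψ) →
        ((∀ t : ℝ, 0 < t → IsFreeMeixner (Phi (freePow ρ t) (freePow ψ t))) ↔
          (IsFreeMeixner ρ ∧
            ∃ s α : ℝ, -1 ≤ s ∧ ψ = freeConv (freePow ρ (1 + s)) (dirac α)))) ∧
    -- the characterization, for a normalized free Meixner `Φ[ρ, ψ]`
    (∀ ρ ψ : Functional,
      IsFreelyInfinitelyDivisible ρ → IsFreelyInfinitelyDivisible ψ →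
        IsNormalizedFreeMeixner (Phi ρ ψ) →
        ((∀ t : ℝ, 0 < t → IsFreeMeixner (Phi (freePow ρ t) (freePow ψ t))) ↔
          (IsNormalizedFreeMeixner ρ ∧
            ∃ s α : ℝ, -1 ≤ s ∧ ψ = freeConv (freePow ρ (1 + s)) (dirac α)))) ∧
    -- the Boolean evolution preserves the free Meixner class
    (∀ ρ : Functional, IsFreelyInfinitelyDivisible ρ → IsFreeMeixner (Phi ρ (dirac 0)) →
      ∀ t : ℝ, 0 < t → IsFreeMeixner (Phi (freePow ρ t) (freePow (dirac 0) t))) ∧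
    -- the free evolution preserves the free Meixner class
    (∀ ρ : Functional, IsFreelyInfinitelyDivisible ρ → IsFreeMeixner (Phi ρ ρ) →
      ∀ t : ℝ, 0 < t → IsFreeMeixner (Phi (freePow ρ t) (freePow ρ t))) ∧
    -- the general c-free evolution does not
    (∃ ρ ψ : Functional,
      IsFreelyInfinitelyDivisible ρ ∧ IsFreelyInfinitelyDivisible ψ ∧
        IsNormalizedFreeMeixner (Phi ρ ψ) ∧
        ∃ t : ℝ, 0 < t ∧ ¬ IsFreeMeixner (Phi (freePow ρ t) (freePow ψ t))) := by
  refine ⟨?_, ?_, fun ρ _ h t ht => h.boolean_evolution ht, ?_, exists_not_isFreeMeixner⟩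
  · intro ρ ψ hρ hψ h
    obtain ⟨a, v, b, d, hv, -, h⟩ := isFreeMeixner_iff.1 h
    constructor
    · intro ht
      obtain ⟨⟨b', d', hd', h'⟩, hs⟩ := h.of_evolution hρ.1.map_one hψ.1.map_one hv ht
      exact ⟨isFreeMeixner_iff.2 ⟨a, v, b', d', hv, hd', h'⟩, hs⟩
    · rintro ⟨hM, s, α, hs, e⟩ t ht
      exact hM.evolution hρ hψ.1.map_one hs e ht
  · intro ρ ψ hρ hψ h
    obtain ⟨b, d, -, h⟩ := isNormalizedFreeMeixner_iff.1 h
    constructor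
    · intro ht
      obtain ⟨h', hs⟩ := h.of_evolution hρ.1.map_one hψ.1.map_one one_pos ht
      exact ⟨isNormalizedFreeMeixner_iff.2 h', hs⟩
    · rintro ⟨hM, s, α, hs, e⟩ t ht
      exact hM.isFreeMeixner.evolution hρ hψ.1.map_one hs e ht
  · intro ρ hρ h t ht
    rw [Phi_self hρ.1.map_one] at h
    -- Since Φ[ρ,ρ] = ρ, this is the converse direction with s = α = 0.
    refine h.evolution hρ hρ.1.map_one (s := 0) (α := 0) (by norm_num) ?_ ht
    rw [eq_freeConv_freePow_dirac_iff hρ.1.map_one]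
    simp
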